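/- **Setting.** Let $T$ be a complete first-order theory in a language $\mathcal L$, and let $\mathfrak C$ be a monster model of $T$: for an uncountable strong limit cardinal $\theta>|\mathcal L|$ (the monstrosity), $\mathfrak C$ is $\theta$-saturated and strongly $\theta$-homogeneous. "Small" means of cardinality $<\theta$. Let $\perp$ be a symmetric independence relation on $\mathfrak C$, i.e. a relation $A\perp_B C$ between small subsets of $\mathfrak C$ such that, for all small $A,B,C,D$: - (Invariance) $A\perp_BC$ implies $\sigma(A)\perp_{\sigma(B)}\sigma(C)$ for each $\sigma\in\mathrm{Aut}(\mathfrak C)$; - (Normality) $A\perp_CB$ implies $A\cup C\perp_CB$; - (Symmetry) $A\perp_BC$ implies $C\perp_BA$; - (Transitivity) if $B\subseteq C\subseteq D$, then $A\perp_BD$ iff $A\perp_BC$ and $A\perp_CD$; - (Finite character) $A\perp_BC$ iff $A_0\perp_BC$ for all finite $A_0\subseteq A$; - (Extension) there is $A'\equiv_BA$ with $A'\perp_BC$; - (Local character) for some small cardinal $\lambda$ depending only on $\perp$, there is always $C_0\subseteq C$ with $|C_0|<\lambda+|A|^+$ and $A\perp_{C_0}C$. Let $\kappa_0$ be the least regular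 cardinal $\lambda$ such that for every finite tuple $\bar a$ and small $B$ there is $B_0\subseteq B$ with $|B_0|<\lambda$ and $\bar a\perp_{B_0}B$. The relation $\perp$ is *superior* if $\kappa_0=\omega$. For arbitrary $A,B,C\subseteq\mathfrak C$, $A\perp_BC$ means that for all small $A'\subseteq A$, $B'\subseteq B$, $C'\subseteq C$ there is a small $B''$ with $B'\subseteq B''\subseteq B$ and $A'\perp_{B''}C'$. A type $q$ satisfies $q\perp_BC$ if some realization of $q$ is independent from $C$ over $B$. **Lovely pairs.** Let $\mathcal L^2=\mathcal L\cup\{P\}$, with $P$ a new unary predicate, and fix a small cardinal $\kappa>\max(\kappa_0,|T|)$, where $|T|=|\mathcal L|+\aleph_0$. For $M\preceq\mathfrak C$ and $P(M)\subseteq M$, consider the following two properties, for all $A\subseteq M$ with $|A|<\kappa$ and all complete $\mathcal L$-$1$-types $q$ over $A$: - (Density) if $q\perp_{A\cap P(M)}A$, then $q$ is realized in $P(M)$; - (Extension) $q$ has a realization $b\in M$ with $b\perp_AP(M)$. A *lovely pair* is a pair $(M,P(M))$ with $M\preceq\mathfrak C$ small that satisfies both. Let $T^d$ be the $\mathcal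 L^2$-theory of all lovely pairs. Assume that loveliness is first-order: for some small $\mu$, each $\mu$-saturated model $(M,P(M))$ of $T^d$ with $M\preceq\mathfrak C$ satisfies Density and Extension. Finally, let $P\subseteq\mathfrak C$ be such that $\mathfrak C_P=(\mathfrak C,P)$ is a monster model (of monstrosity $\theta$) of $T^d$, and define $A\,(\perp_P)_B\,C$ to mean $A\perp_{B\cup P}C$. **Ranks.** Given a ternary relation $\perp$ as above, a complete type $q$ over a small $C\supseteq B$ is a forking extension of a complete type $p$ over $B$ if $q\supseteq p$ and not $q\perp_BC$. The rank $\mathrm U(p)\in\mathrm{Ord}\cup\{\infty\}$ is determined by: $\mathrm U(p)\ge\alpha$ iff for every $\beta<\alpha$ some forking extension $q$ of $p$ to a small set has $\mathrm U(q)\ge\beta$. The rank of a partial type over $B$ is the supremum of the ranks of the complete types over $B$ extending it. Let $\mathrm U$ be the rank obtained from $\perp$ on $\mathcal L$-types of $\mathfrak C$, and $\mathrm U^P$ the rank obtained from $\perp_P$ on $\mathcal L^2$-types of $\mathfrak C_P$; an $\mathcal L$-type is also a partial $\mathcal L^2$-type, so both apply to it. **Lemma.** Assume that $\perp$ is superior.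 Then for every small $B\subseteq\mathfrak C$, every $n$ and every complete $\mathcal L$-type $q\in S_n(B)$ we have $\mathrm U(q)=\mathrm U^P(q)$. Likewise $\mathrm U(\pi)=\mathrm U^P(\pi)$ for every partial $\mathcal L$-type $\pi$ over a small set $B$ in finitely many variables. -/

import Mathlib

open FirstOrder FirstOrder.Language Cardinal

universe u

namespace LovelyPairs

/-! ### Types over sets of parameters -/

section Types

variable (L : FirstOrder.Language.{u, u}) (M : Type u) [L.Structure M]

/-- `S_n(B)`: complete `n`-types over the parameter set `B ⊆ M`, i.e. complete types of the theory
of `M` with the elements of `B` named. -/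
abbrev TypeOver (B : Set M) (n : ℕ) : Type u :=
  (L[[B]].completeTheory M).CompleteType (Fin n)

/-- Partial `n`-types over `B`: sets of formulas with parameters in `B` (consistency is not part of
the definition; an inconsistent set has no completions). -/
abbrev PartialTypeOver (B : Set M) (n : ℕ) : Type u :=
  Set (L[[B]].Formula (Fin n))

variable {L M}

/-- The tuple `a` realizes the partial type `π`. -/
def Realizes {B : Set M} {n : ℕ} (a : Fin n → M) (π : PartialTypeOver L M B n) : Prop :=
  ∀ φ ∈ π, φ.Realize a

/-- A complete type, viewed as the set of all formulas that belong to it. -/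
def formulas {B : Set M} {n : ℕ} (q : TypeOver L M B n) : PartialTypeOver L M B n :=
  {φ | Formula.equivSentence φ ∈ q}

/-- A formula over `A`, read as a formula over the larger set `B`. -/
def enlarge {A B : Set M} (h : A ⊆ B) {n : ℕ} (φ : L[[A]].Formula (Fin n)) :
    L[[B]].Formula (Fin n) :=
  (L.lhomWithConstantsMap (Set.inclusion h)).onFormula φ

/-- The type `q` over `B` extends the type `p` over `A ⊆ B`. -/
def Extends {A B : Set M} (h : A ⊆ B) {n : ℕ} (q : TypeOver L M B n) (p : TypeOver L M A n) :
    Prop :=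
  ∀ φ ∈ formulas p, enlarge h φ ∈ formulas q

end Types

/-! ### Monster models -/

section Monster

variable (L : FirstOrder.Language.{u, u}) (M : Type u) [L.Structure M]

/-- `M` is `μ`-saturated: every finitely satisfiable set of formulas in finitely many variables,
with parameters in a set of cardinality `< μ`, is realized in `M`. -/
def IsSaturated (μ : Cardinal.{u}) : Prop :=
  ∀ A : Set M, #A < μ → ∀ (n : ℕ) (Γ : PartialTypeOver L M A n),
    (∀ Γ₀ ⊆ Γ, Γ₀.Finite → ∃ a : Fin n → M, Realizes a Γ₀) → ∃ a : Fin n → M, Realizes a Γ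

/-- `M` is strongly `μ`-homogeneous: every partial elementary map whose domain has cardinality
`< μ` extends to an automorphism of `M`. -/
def IsStronglyHomogeneous (μ : Cardinal.{u}) : Prop :=
  ∀ A : Set M, #A < μ → ∀ f : A → M,
    (∀ (n : ℕ) (φ : L.Formula (Fin n)) (v : Fin n → A),
      φ.Realize (fun i => (v i : M)) ↔ φ.Realize (fun i => f (v i))) →
    ∃ σ : M ≃[L] M, ∀ a : A, σ a = f a

/-- `M` is a monster model of its theory, with monstrosity `θ`. -/
structure IsMonster (θ : Cardinal.{u}) : Prop where
  isStrongLimit : θ.IsStrongLimit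
  aleph0_lt : ℵ₀ < θ
  card_lt : L.card < θ
  saturated : IsSaturated L M θ
  homogeneous : IsStronglyHomogeneous L M θ

end Monster

/-! ### Independence relations

A ternary relation `R : Set M → Set M → Set M → Prop` is read as follows: `R A B C` means that `A`
is independent from `C` over `B`. A set is small if its cardinality is less than the monstrosity
`θ`. -/

section Independence

variable (L : FirstOrder.Language.{u, u}) {M : Type u} [L.Structure M] (θ : Cardinal.{u})

/-- `R` is a symmetric independence relation on the small subsets of the monster model `M`. -/
structure IsIndependenceRelation (R : Set M → Set M → Set M → Prop) : Prop where
  invariance : ∀ A B C : Set M, #A < θ → #B < θ → #C < θ → ∀ σ : M ≃[L] M,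
    R A B C → R (σ '' A) (σ '' B) (σ '' C)
  normality : ∀ A B C : Set M, #A < θ → #B < θ → #C < θ → R A C B → R (A ∪ C) C B
  symmetry : ∀ A B C : Set M, #A < θ → #B < θ → #C < θ → R A B C → R C B A
  transitivity : ∀ A B C D : Set M, #A < θ → #B < θ → #C < θ → #D < θ → B ⊆ C → C ⊆ D →
    (R A B D ↔ R A B C ∧ R A C D)
  finite_character : ∀ A B C : Set M, #A < θ → #B < θ → #C < θ →
    (R A B C ↔ ∀ A₀ ⊆ A, A₀.Finite → R A₀ B C)
  /-- In the monster model, `A' ≡_B A` means that `A'` is the image of `A` under an automorphism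
  that fixes `B` pointwise. -/
  extension : ∀ A B C : Set M, #A < θ → #B < θ → #C < θ →
    ∃ σ : M ≃[L] M, (∀ b ∈ B, σ b = b) ∧ R (σ '' A) B C
  local_character : ∃ κ₀ < θ, ∀ A C : Set M, #A < θ → #C < θ →
    ∃ C₀ ⊆ C, #C₀ < κ₀ + Order.succ #A ∧ R A C₀ C

variable {L}

/-- `κ₀`: the least regular cardinal `κ` such that for every finite tuple `a` and every small `B`
there is `B₀ ⊆ B` of cardinality `< κ` with `a` independent from `B` over `B₀`. -/
noncomputable def kappaZero (R : Set M → Set M → Set M → Prop) : Cardinal.{u} :=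
  sInf {κ | κ.IsRegular ∧ ∀ (n : ℕ) (a : Fin n → M) (B : Set M), #B < θ →
    ∃ B₀ ⊆ B, #B₀ < κ ∧ R (Set.range a) B₀ B}

/-- The independence relation is superior if `κ₀ = ω`. -/
def IsSuperior (R : Set M → Set M → Set M → Prop) : Prop :=
  kappaZero θ R = ℵ₀

/-- Independence for arbitrary, possibly large, subsets of the monster model. On small sets this
agrees with `R` (by monotonicity and base monotonicity of an independence relation). -/
def IndepLarge (R : Set M → Set M → Set M → Prop) (A B C : Set M) : Prop :=
  ∀ A' ⊆ A, ∀ B' ⊆ B, ∀ C' ⊆ C, #A' < θ → #B' < θ → #C' < θ →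
    ∃ B'', B' ⊆ B'' ∧ B'' ⊆ B ∧ #B'' < θ ∧ R A' B'' C'

/-- The complete type `q` over `B` is independent from `C` over `A`: some realization of `q`
is. -/
def TypeIndep (R : Set M → Set M → Set M → Prop) {B : Set M} {n : ℕ} (q : TypeOver L M B n)
    (A C : Set M) : Prop :=
  ∃ a : Fin n → M, Realizes a (formulas q) ∧ R (Set.range a) A C

/-- `q`, a type over `B`, is a forking extension of `p`, a type over `A ⊆ B`. -/
def IsForkingExtension (R : Set M → Set M → Set M → Prop) {A B : Set M} (h : A ⊆ B) {n : ℕ}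
    (q : TypeOver L M B n) (p : TypeOver L M A n) : Prop :=
  Extends h q p ∧ ¬ TypeIndep R q A B

/-! ### The rank induced by an independence relation -/

/-- `U(p) ≥ α`, defined by recursion on the ordinal `α`: for every `β < α` there is a forking
extension `q` of `p` to a small set with `U(q) ≥ β`. -/
def RankGE (R : Set M → Set M → Set M → Prop) {n : ℕ} (α : Ordinal.{u}) {B : Set M}
    (p : TypeOver L M B n) : Prop :=
  ∀ β, ∀ _ : β < α, ∃ (C : Set M) (h : B ⊆ C) (q : TypeOver L M C n),
    #C < θ ∧ IsForkingExtension R h q p ∧ RankGE R β q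
termination_by α

/-- The rank `U(p)` of a complete type: the largest `α` such that `U(p) ≥ α`, and `⊤` (that is,
`∞`) if there is no largest one. -/
noncomputable def rank (R : Set M → Set M → Set M → Prop) {B : Set M} {n : ℕ}
    (p : TypeOver L M B n) : WithTop Ordinal.{u} :=
  sSup {x | ∃ α : Ordinal.{u}, x = α ∧ RankGE θ R α p}

/-- The rank of a partial type over `B`: the supremum of the ranks of the complete types over `B`
that extend it. -/
noncomputable def partialRank (R : Set M → Set M → Set M → Prop) {B : Set M} {n : ℕ}
    (π : PartialTypeOver L M B n) : WithTop Ordinal.{u} :=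
  ⨆ q : {q : TypeOver L M B n // π ⊆ formulas q}, rank θ R q.1

end Independence

/-! ### Pairs -/

/-- The relation symbols of the language `{P}`: a single unary one. -/
inductive PredRel : ℕ → Type u
  | P : PredRel 1

/-- The language whose only symbol is the unary predicate `P`. -/
def predLang : FirstOrder.Language.{u, u} where
  Functions _ := PEmpty
  Relations := PredRel

/-- `L² = L ∪ {P}`. -/
abbrev L2 (L : FirstOrder.Language.{u, u}) : FirstOrder.Language.{u, u} := L.sum predLang.{u}

/-- The set `X`, with `P` interpreted by `Q ⊆ X`. -/
def Pair (X : Type u) (_Q : Set X) : Type u := X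

section Pair

variable (L : FirstOrder.Language.{u, u}) {X : Type u} (Q : Set X)

instance [L.Structure X] : L.Structure (Pair X Q) := inferInstanceAs (L.Structure X)

instance : predLang.{u}.Structure (Pair X Q) where
  funMap f := f.elim
  RelMap r := match r with
    | PredRel.P => fun x => (x 0 : X) ∈ Q

instance [Nonempty X] : Nonempty (Pair X Q) := inferInstanceAs (Nonempty X)

variable {L Q} [L.Structure X]

/-- A partial `L`-type over `B`, viewed as a partial `L²`-type over `B`. -/
def toL2 {B : Set X} {n : ℕ} (π : PartialTypeOver L X B n) :
    PartialTypeOver (L2 L) (Pair X Q) (B : Set X) n :=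
  ((LHom.sumInl : L →ᴸ L2 L).addConstants B).onFormula '' π

end Pair

/-! ### Lovely pairs -/

section Lovely

variable (L : FirstOrder.Language.{u, u}) {M : Type u} [L.Structure M] (θ : Cardinal.{u})
  (R : Set M → Set M → Set M → Prop) (κ : Cardinal.{u})

/-- The structure `N_P = (N, Q)`, where `N` is an elementary substructure of the monster `M` and
`Q ⊆ N`. -/
abbrev subPair {L : FirstOrder.Language.{u, u}} {M : Type u} [L.Structure M] (N : L.ElementarySubstructure M)
    (Q : Set M) : Type u :=
  Pair N {x : N | (x : M) ∈ Q}

/-- Density property of `(N, Q)`: if `A ⊆ N` has cardinality `< κ`, then each complete `L`-1-type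
over `A` that does not fork over `Q ∩ A` is realized in `Q`. -/
def DensityProperty (N : L.ElementarySubstructure M) (Q : Set M) : Prop :=
  ∀ A : Set M, A ⊆ N → #A < κ → ∀ q : TypeOver L M A 1, TypeIndep R q (Q ∩ A) A →
    ∃ c : Fin 1 → M, c 0 ∈ Q ∧ Realizes c (formulas q)

/-- Extension property of `(N, Q)`: if `A ⊆ N` has cardinality `< κ`, then each complete
`L`-1-type over `A` is realized by some `b ∈ N` that is independent from `Q` over `A`. -/
def ExtensionProperty (N : L.ElementarySubstructure M) (Q : Set M) : Prop :=
  ∀ A : Set M, A ⊆ N → #A < κ → ∀ q : TypeOver L M A 1,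
    ∃ b : Fin 1 → M, b 0 ∈ N ∧ Realizes b (formulas q) ∧ IndepLarge θ R (Set.range b) A Q

/-- `(N, Q)` is a (`κ`-)lovely pair. -/
structure IsLovelyPair (N : L.ElementarySubstructure M) (Q : Set M) : Prop where
  subset : Q ⊆ N
  small : #N < θ
  density : DensityProperty L R κ N Q
  extension : ExtensionProperty L θ R κ N Q

/-- `T^d`: the `L²`-theory of lovely pairs. -/
def lovelyTheory : (L2 L).Theory :=
  {σ | ∀ (N : L.ElementarySubstructure M) (Q : Set M), IsLovelyPair L θ R κ N Q →
    subPair N Q ⊨ σ}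

/-- Loveliness is first-order: every sufficiently saturated model of `T^d` (with universe an
elementary substructure of the monster, possibly the monster itself) satisfies the density property
and the extension property. -/
def LovelinessIsFirstOrder : Prop :=
  ∃ μ < θ, ∀ (N : L.ElementarySubstructure M) (Q : Set M), Q ⊆ N →
    subPair N Q ⊨ lovelyTheory L θ R κ → IsSaturated (L2 L) (subPair N Q) μ →
      DensityProperty L R κ N Q ∧ ExtensionProperty L θ R κ N Q

end Lovely

/-- The relation induced by `R` on subsets of `(M, P)`: `A` is independent from `C` over `B` if it
is so over `B ∪ P` in the sense of `R`. -/
def indepP {M : Type u} (θ : Cardinal.{u}) (R : Set M → Set M → Set M → Prop) (P : Set M) :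
    Set (Pair M P) → Set (Pair M P) → Set (Pair M P) → Prop :=
  fun A B C => IndepLarge (M := M) θ R A (B ∪ P : Set M) C

end LovelyPairs

/-!
Forking in the pair `(M, P)` over `B` is forking over `B ∪ P`, so the two ranks agree on tuples that
are independent from `P` over `B`; the argument compares them along such tuples. All manipulations
are done with tuples of the two monster models and their automorphisms instead of types: by strong
homogeneity, `U(a/B) ≥ α` holds if and only if for each `β < α` there is a small `C ⊇ B` with `a`
dependent on `C` over `B` and `U(a/C) ≥ β` (`rankGE_tp_iff`).

*The rank in the pair is not larger* (`RankGE.of_pair`). By superiority, any finite tuple `a` is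
independent from `P` over `B ∪ P₀` for a finite `P₀ ⊆ P` (`IsSuperior.exists_freeFrom`). If `a`
depends on `C` over `B ∪ P` and is independent from `P` over `C ∪ P₁`, where `P₀ ⊆ P₁ ⊆ P`, then `a`
depends on `C ∪ P₁` over `B ∪ P₀`. Thus a chain of forking extensions in the pair gives a chain of
the same length for `L`-types over `B ∪ P₀`, and `U(a/B ∪ P₀) ≤ U(a/B)`.

*The rank in the pair is not smaller* (`RankGE.pair_of_freeFrom`). Let `a` be independent from `P`
over `B` and dependent on `C` over `B`. Then it depends on a finite tuple `c` of `C`, and if `c` is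
moved to be independent from `P` over `B` and `a`, then `a` still depends on `c` over `B ∪ P`, and
remains independent from `P` over `B` and `c`.

The second part needs that every finite tuple has a conjugate over any given small set `B` that is
independent from `P` over `B` (`exists_aut_freeFrom`). For finite `B` this is the extension property
of lovely pairs, but `B` can have cardinality `κ` or more. There is no definability of independence
to appeal to, and the theory of the pair need not be complete (`R` could hold of all triples of
sets). What holds is the following. If `D` is finite and independent from `P` over `P ∩ D`, then all
conjugates `b` of a tuple `c` over `D` that are independent from `P` over `D` satisfy the same
formulas `∃ y ∈ P, φ(x, y)` with `φ` an `L`-formula over `D`, because the density property moves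
tuples of `P` from one to another (`DensityProperty.exists_aut_eqOn`). So, once `B` has been
enlarged by a small part of `P` such that its finite subsets lie in sets `D ⊆ B` of this kind
(`exists_small_bases`), these formulas can be prescribed at once for all such `D` that contain a
fixed finite base for the independence of `c` from `B`, and by saturation of the pair a single tuple
`c'` realizes the result (`exists_forall_isFreeConj`). If `c'` depended on `p ∈ P` over `B`, it
would do so over some finite `D`, and by saturation `c' p` would be conjugate over `D` to `b p'`
with `p' ∈ P`, which contradicts the independence of `b` from `P` over `D`.
-/

namespace LovelyPairs

/-! ### Types, saturation and homogeneity -/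

section ModelTheory

variable {L : FirstOrder.Language.{u, u}} {M : Type u} [L.Structure M]

variable (L) in
/-- The tuples `x` and `y` have the same type over the empty set. -/
def SameType {ι : Type u} (x y : ι → M) : Prop :=
  ∀ φ : L.Formula ι, φ.Realize x ↔ φ.Realize y

theorem sameType_of_imp {ι : Type u} {x y : ι → M}
    (h : ∀ φ : L.Formula ι, φ.Realize x → φ.Realize y) : SameType L x y := fun φ =>
  ⟨h φ, fun hy => by
    by_contra hx
    exact h φ.not hx hy⟩

/-- A formula with parameters in `B`, obtained from a formula with variables for them. -/
def withParams {B : Set M} {n : ℕ} (ψ : L.Formula (B ⊕ Fin n)) : L[[B]].Formula (Fin n) :=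
  BoundedFormula.constantsVarsEquiv.symm ψ

theorem realize_withParams {B : Set M} {n : ℕ} (ψ : L.Formula (B ⊕ Fin n)) (a : Fin n → M) :
    (withParams ψ).Realize a ↔ ψ.Realize (Sum.elim (fun b : B => (b : M)) a) := by
  have := BoundedFormula.realize_constantsVarsEquiv (L := L) (M := M)
    (φ := (BoundedFormula.constantsVarsEquiv.symm ψ : L[[B]].Formula (Fin n)))
    (v := a) (xs := default)
  rw [Equiv.apply_symm_apply] at this
  exact this.symm

omit [L.Structure M] in
theorem exists_eq_withParams {B : Set M} {n : ℕ} (φ : L[[B]].Formula (Fin n)) :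
    ∃ ψ : L.Formula (B ⊕ Fin n), φ = withParams ψ :=
  ⟨BoundedFormula.constantsVarsEquiv φ, (Equiv.symm_apply_apply _ φ).symm⟩

/-- Saturation, with parameters given by a family of variables instead of constants. -/
theorem IsSaturated.exists_realize {μ : Cardinal.{u}} (h : IsSaturated L M μ) {ι : Type u}
    (hι : #ι < μ) (x : ι → M) {n : ℕ} (Γ : Set (L.Formula (ι ⊕ Fin n)))
    (hΓ : ∀ Γ₀ ⊆ Γ, Γ₀.Finite → ∃ a : Fin n → M, ∀ φ ∈ Γ₀, φ.Realize (Sum.elim x a)) :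
    ∃ a : Fin n → M, ∀ φ ∈ Γ, φ.Realize (Sum.elim x a) := by
  -- `x` need not be injective: a variable is replaced by the constant for its value.
  let t : L.Formula (ι ⊕ Fin n) → L[[Set.range x]].Formula (Fin n) := fun φ =>
    withParams (φ.relabel (Sum.map (Set.rangeFactorization x) id))
  have ht : ∀ φ a, (t φ).Realize a ↔ φ.Realize (Sum.elim x a) := by
    intro φ a
    rw [realize_withParams, Formula.realize_relabel]
    have : (Sum.elim (fun b : Set.range x => (b : M)) a ∘
        Sum.map (Set.rangeFactorization x) id) = Sum.elim x a := by
      ext (i | i) <;> rfl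
    rw [this]
  obtain ⟨a, ha⟩ := h (Set.range x) (mk_range_le.trans_lt hι) n (t '' Γ) (by
    intro Γ₀ h₀ hfin
    obtain ⟨Γ₁, h₁, hfin₁, rfl⟩ :
        ∃ Γ₁ ⊆ Γ, Γ₁.Finite ∧ Γ₀ = t '' Γ₁ :=
      Set.exists_subset_image_finite_and.1 ⟨Γ₀, h₀, hfin, rfl⟩
    obtain ⟨a, ha⟩ := hΓ Γ₁ h₁ hfin₁
    refine ⟨a, ?_⟩
    rintro _ ⟨φ, hφ, rfl⟩
    exact (ht φ a).2 (ha φ hφ))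
  exact ⟨a, fun φ hφ => (ht φ a).1 (ha _ ⟨φ, hφ, rfl⟩)⟩

/-- Strong homogeneity: tuples of the same type are conjugate. -/
theorem IsStronglyHomogeneous.exists_aut {μ : Cardinal.{u}} (h : IsStronglyHomogeneous L M μ)
    {ι : Type u} (hι : #ι < μ) {x y : ι → M} (hxy : SameType L x y) :
    ∃ σ : M ≃[L] M, ∀ i, σ (x i) = y i := by
  have hwd : ∀ i j, x i = x j → y i = y j := by
    intro i j hij
    have := (hxy (Term.equal (Term.var i) (Term.var j))).1 (by simpa using hij)
    simpa using this
  choose g hg using fun a : Set.range x => a.2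
  obtain ⟨σ, hσ⟩ := h (Set.range x) (mk_range_le.trans_lt hι) (fun a => y (g a)) (by
    intro n φ v
    have := hxy (φ.relabel fun i => g (v i))
    rw [Formula.realize_relabel, Formula.realize_relabel] at this
    have hx : (x ∘ fun i => g (v i)) = fun i => (v i : M) := funext fun i => hg (v i)
    rwa [hx] at this)
  exact ⟨σ, fun i => (hσ ⟨x i, i, rfl⟩).trans (hwd _ _ (hg ⟨x i, i, rfl⟩))⟩

/-- The enumeration of `B` by itself, together with the tuple `a`. Two tuples have the same type
over `B` when their joint tuples with `B` have the same type over the empty set. -/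
def joint (B : Set M) {n : ℕ} (a : Fin n → M) : (B ⊕ Fin n) → M :=
  Sum.elim (fun b : B => (b : M)) a

theorem realizes_formulas_iff [Nonempty M] {B : Set M} {n : ℕ} {q : TypeOver L M B n}
    {a : Fin n → M} : Realizes a (formulas q) ↔ q = (L[[B]].completeTheory M).typeOf a := by
  constructor
  · intro h
    have key : ∀ φ : L[[B]][[Fin n]].Sentence, φ ∈ q →
        φ ∈ (L[[B]].completeTheory M).typeOf a := by
      intro φ hφ
      rw [Theory.CompleteType.mem_typeOf]
      apply h
      change Formula.equivSentence (Formula.equivSentence.symm φ) ∈ q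
      rwa [Equiv.apply_symm_apply]
    refine SetLike.ext fun φ => ⟨key φ, fun hφ => ?_⟩
    rcases q.mem_or_not_mem φ with h1 | h1
    · exact h1
    · exact absurd hφ (((Theory.CompleteType.not_mem_iff _ φ).1 (key _ h1)))
  · rintro rfl φ hφ
    exact (Theory.CompleteType.formula_mem_typeOf (T := L[[B]].completeTheory M)).1 hφ

theorem mem_formulas_typeOf [Nonempty M] {B : Set M} {n : ℕ} {a : Fin n → M}
    {φ : L[[B]].Formula (Fin n)} :
    φ ∈ formulas ((L[[B]].completeTheory M).typeOf a) ↔ φ.Realize a :=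
  Theory.CompleteType.formula_mem_typeOf (T := L[[B]].completeTheory M)

variable (L) in
/-- The type of the tuple `a` over the set `B`. -/
abbrev tp [Nonempty M] (B : Set M) {n : ℕ} (a : Fin n → M) : TypeOver L M B n :=
  (L[[B]].completeTheory M).typeOf a

theorem realizes_tp_iff [Nonempty M] {B : Set M} {n : ℕ} {a b : Fin n → M} :
    Realizes b (formulas (tp L B a)) ↔ SameType L (joint B a) (joint B b) := by
  constructor
  · intro h
    apply sameType_of_imp
    intro φ hφ
    have := h (withParams φ) (mem_formulas_typeOf.2 ((realize_withParams φ a).2 hφ))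
    exact (realize_withParams φ b).1 this
  · intro h φ hφ
    obtain ⟨ψ, rfl⟩ := exists_eq_withParams φ
    rw [mem_formulas_typeOf, realize_withParams] at hφ
    exact (realize_withParams _ _).2 ((h ψ).1 hφ)

theorem tp_eq_iff [Nonempty M] {B : Set M} {n : ℕ} {a b : Fin n → M} :
    tp L B a = tp L B b ↔ SameType L (joint B a) (joint B b) := by
  rw [← realizes_formulas_iff, realizes_tp_iff]

theorem extends_tp_iff [Nonempty M] {A B : Set M} (h : A ⊆ B) {n : ℕ} {a b : Fin n → M} :
    Extends h (tp L B b) (tp L A a) ↔ tp L A a = tp L A b := by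
  rw [← realizes_formulas_iff]
  have : ∀ φ : L[[A]].Formula (Fin n), enlarge h φ ∈ formulas (tp L B b) ↔ φ.Realize b := by
    intro φ
    rw [mem_formulas_typeOf]
    exact LHom.realize_onFormula _ _
  constructor
  · intro he φ hφ
    exact (this φ).1 (he φ hφ)
  · intro he φ hφ
    exact (this φ).2 (he φ hφ)

/-- In a saturated structure, every complete type over a small set is realized. -/
theorem IsSaturated.exists_eq_tp [Nonempty M] {μ : Cardinal.{u}} (h : IsSaturated L M μ)
    {B : Set M} (hB : #B < μ) {n : ℕ} (q : TypeOver L M B n) : ∃ a : Fin n → M, q = tp L B a := by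
  obtain ⟨a, ha⟩ := h B hB n (formulas q) (by
    intro Γ₀ h₀ hfin
    obtain ⟨N, v, hv⟩ := Theory.exists_modelType_is_realized_in _ q
    have : Finite Γ₀ := hfin
    have h1 : ∃ w : Fin n → N, (Formula.iInf fun φ : Γ₀ => (φ : L[[B]].Formula (Fin n))).Realize w := by
      refine ⟨v, ?_⟩
      rw [Formula.realize_iInf]
      intro φ
      have := h₀ φ.2
      change Formula.equivSentence (φ : L[[B]].Formula (Fin n)) ∈ q at this
      rw [← hv] at this
      exact (Theory.CompleteType.formula_mem_typeOf (T := L[[B]].completeTheory M)).1 this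
    let χ : L[[B]].Sentence := Formula.iExs (Fin n)
      (Formula.relabel Sum.inr (Formula.iInf fun φ : Γ₀ => (φ : L[[B]].Formula (Fin n))))
    have h2 : (N : Type u) ⊨ χ := by
      rw [Sentence.Realize, Formula.realize_iExs]
      obtain ⟨w, hw⟩ := h1
      refine ⟨w, ?_⟩
      rw [Formula.realize_relabel]
      exact hw
    have h3 : M ⊨ χ := (Theory.IsComplete.realize_sentence_iff
        (completeTheory.isComplete (L[[B]]) M) χ M).2
      ((Theory.IsComplete.realize_sentence_iff
        (completeTheory.isComplete (L[[B]]) M) χ N).1 h2)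
    rw [Sentence.Realize, Formula.realize_iExs] at h3
    obtain ⟨w, hw⟩ := h3
    rw [Formula.realize_relabel, Formula.realize_iInf] at hw
    exact ⟨w, fun φ hφ => hw ⟨φ, hφ⟩⟩)
  exact ⟨a, realizes_formulas_iff.1 ha⟩

/-- Tuples that have the same type over a small set are conjugate over it. -/
theorem exists_aut_of_tp_eq [Nonempty M] {θ : Cardinal.{u}} (hM : IsMonster L M θ)
    {B : Set M} (hB : #B < θ) {n : ℕ} {a b : Fin n → M} (hab : tp L B a = tp L B b) :
    ∃ σ : M ≃[L] M, (∀ x ∈ B, σ x = x) ∧ σ ∘ a = b := by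
  obtain ⟨σ, hσ⟩ := hM.homogeneous.exists_aut (ι := B ⊕ Fin n) (by
      rw [mk_sum]
      refine add_lt_of_lt hM.aleph0_lt.le (by rwa [lift_uzero]) ?_
      exact (lift_lt_aleph0.2 (lt_aleph0_of_finite _)).trans hM.aleph0_lt) (tp_eq_iff.1 hab)
  exact ⟨σ, fun x hx => hσ (Sum.inl ⟨x, hx⟩), funext fun i => hσ (Sum.inr i)⟩

theorem tp_comp_aut [Nonempty M] {B : Set M} {n : ℕ} (a : Fin n → M) (σ : M ≃[L] M)
    (hσ : ∀ x ∈ B, σ x = x) : tp L B (σ ∘ a) = tp L B a := by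
  rw [eq_comm, tp_eq_iff]
  have : joint B (σ ∘ a) = σ ∘ joint B a := by
    ext (i | i)
    · exact (hσ i i.2).symm
    · rfl
  rw [this]
  intro φ
  exact (StrongHomClass.realize_formula σ φ).symm

/-- A formula only involves finitely many of its variables. -/
theorem exists_finite_relabel {α : Type u} {β : Type} (φ : L.Formula (α ⊕ β)) :
    ∃ (s : Set α), s.Finite ∧ ∃ ψ : L.Formula (s ⊕ β),
      ∀ v : α ⊕ β → M, φ.Realize v ↔ ψ.Realize (v ∘ Sum.map (fun a : s => (a : α)) id) := by
  classical
  let s : Set α := {a | Sum.inl a ∈ φ.freeVarFinset}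
  have hs : s.Finite := (φ.freeVarFinset.finite_toSet).preimage (Sum.inl_injective.injOn)
  let f : φ.freeVarFinset → s ⊕ β := fun x => match x with
    | ⟨Sum.inl a, h⟩ => Sum.inl ⟨a, h⟩
    | ⟨Sum.inr b, _⟩ => Sum.inr b
  refine ⟨s, hs, φ.restrictFreeVar f, fun v => ?_⟩
  refine (BoundedFormula.realize_restrictFreeVar (v' := v) ?_).symm
  rintro ⟨a | b, h⟩ <;> rfl

end ModelTheory

/-! ### Small sets -/

section Smallness

variable {M : Type u} {θ : Cardinal.{u}}

theorem mk_union_lt (hθ : ℵ₀ < θ) {A B : Set M} (hA : #A < θ) (hB : #B < θ) :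
    #(A ∪ B : Set M) < θ :=
  (mk_union_le A B).trans_lt (add_lt_of_lt hθ.le hA hB)

theorem mk_lt_of_subset {A B : Set M} (hB : #B < θ) (h : A ⊆ B) : #A < θ :=
  (mk_le_mk_of_subset h).trans_lt hB

theorem mk_lt_of_finite (hθ : ℵ₀ < θ) {A : Set M} (hA : A.Finite) : #A < θ :=
  hA.lt_aleph0.trans hθ

theorem mk_image_lt {A : Set M} (hA : #A < θ) (f : M → M) : #(f '' A) < θ :=
  mk_image_le.trans_lt hA

end Smallness

/-! ### Calculus of independence relations -/

section Calculus

variable {L : FirstOrder.Language.{u, u}} {M : Type u} [L.Structure M] {θ : Cardinal.{u}}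

theorem image_eq_of_fixes {F : Type*} [FunLike F M M] (σ : F) {B : Set M} (h : ∀ b ∈ B, σ b = b) :
    σ '' B = B := by
  rw [Set.image_congr h, Set.image_id']

theorem image_symm_image (σ : M ≃[L] M) (B : Set M) : σ.symm '' (σ '' B) = B := by
  rw [Set.image_image]
  simp

theorem image_image_symm (σ : M ≃[L] M) (B : Set M) : σ '' (σ.symm '' B) = B := by
  rw [Set.image_image]
  simp

namespace IsIndependenceRelation

variable {R : Set M → Set M → Set M → Prop} (hR : IsIndependenceRelation L θ R) (hθ : ℵ₀ < θ)
include hR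

theorem aut_iff {A B C : Set M} (hA : #A < θ) (hB : #B < θ) (hC : #C < θ) (σ : M ≃[L] M) :
    R (σ '' A) (σ '' B) (σ '' C) ↔ R A B C := by
  refine ⟨fun h => ?_, hR.invariance A B C hA hB hC σ⟩
  have := hR.invariance _ _ _ (mk_image_lt hA σ) (mk_image_lt hB σ) (mk_image_lt hC σ) σ.symm h
  simpa only [image_symm_image] using this

/-- Every set is independent from the base. -/
theorem base {A B : Set M} (hA : #A < θ) (hB : #B < θ) : R A B B := by
  obtain ⟨σ, hσ, h⟩ := hR.extension A B B hA hB hB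
  rw [← hR.aut_iff hA hB hB σ, image_eq_of_fixes σ hσ]
  exact h

theorem mono_left {A A' B C : Set M} (hA : #A < θ) (hB : #B < θ) (hC : #C < θ) (h : R A B C)
    (hA' : A' ⊆ A) : R A' B C := by
  rw [hR.finite_character _ _ _ (mk_lt_of_subset hA hA') hB hC]
  exact fun A₀ h₀ hf => (hR.finite_character _ _ _ hA hB hC).1 h A₀ (h₀.trans hA') hf

theorem mono_right {A B C C' : Set M} (hA : #A < θ) (hB : #B < θ) (hC : #C < θ) (h : R A B C)
    (hC' : C' ⊆ C) : R A B C' :=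
  hR.symmetry _ _ _ (mk_lt_of_subset hC hC') hB hA
    (hR.mono_left hC hB hA (hR.symmetry _ _ _ hA hB hC h) hC')

include hθ

theorem union_base_right {A B C : Set M} (hA : #A < θ) (hB : #B < θ) (hC : #C < θ)
    (h : R A B C) : R A B (B ∪ C) := by
  rw [Set.union_comm]
  exact hR.symmetry _ _ _ (mk_union_lt hθ hC hB) hB hA
    (hR.normality _ _ _ hC hA hB (hR.symmetry _ _ _ hA hB hC h))

omit hθ in
theorem union_base_left {A B C : Set M} (hA : #A < θ) (hB : #B < θ) (hC : #C < θ)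
    (h : R A B C) : R (B ∪ A) B C := by
  rw [Set.union_comm]
  exact hR.normality _ _ _ hA hC hB h

/-- Transitivity on the right. -/
theorem trans_right {A B C D : Set M} (hA : #A < θ) (hB : #B < θ) (hC : #C < θ) (hD : #D < θ)
    (h₁ : R A B C) (h₂ : R A (B ∪ C) D) : R A B (C ∪ D) := by
  have hBC := mk_union_lt hθ hB hC
  have hBCD := mk_union_lt hθ hBC hD
  have := (hR.transitivity A B (B ∪ C) (B ∪ C ∪ D) hA hB hBC hBCD Set.subset_union_left
    Set.subset_union_left).2 ⟨hR.union_base_right hθ hA hB hC h₁,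
      hR.union_base_right hθ hA hBC hD h₂⟩
  exact hR.mono_right hA hB hBCD this (by rw [Set.union_assoc]; exact Set.subset_union_right)

/-- Base monotonicity. -/
theorem mono_base {A B B' C C' : Set M} (hA : #A < θ) (hB : #B < θ) (hC : #C < θ)
    (h : R A B C) (h₁ : B ⊆ B') (h₂ : B' ⊆ B ∪ C) (h₃ : C' ⊆ B ∪ C) : R A B' C' := by
  have hBC := mk_union_lt hθ hB hC
  exact hR.mono_right hA (mk_lt_of_subset hBC h₂) hBC
    ((hR.transitivity A B B' (B ∪ C) hA hB (mk_lt_of_subset hBC h₂) hBC h₁ h₂).1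
      (hR.union_base_right hθ hA hB hC h)).2 h₃

/-- Transitivity on the left. -/
theorem trans_left {A B C D : Set M} (hA : #A < θ) (hB : #B < θ) (hC : #C < θ) (hD : #D < θ)
    (h₁ : R A B C) (h₂ : R D (B ∪ A) C) : R (A ∪ D) B C :=
  hR.symmetry _ _ _ hC hB (mk_union_lt hθ hA hD)
    (hR.trans_right hθ hC hB hA hD (hR.symmetry _ _ _ hA hB hC h₁)
      (hR.symmetry _ _ _ hD (mk_union_lt hθ hB hA) hC h₂))

omit hθ in
theorem finite_character_right {A B C : Set M} (hA : #A < θ) (hB : #B < θ) (hC : #C < θ)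
    (h : ∀ C₀ ⊆ C, C₀.Finite → R A B C₀) : R A B C := by
  refine hR.symmetry _ _ _ hC hB hA ((hR.finite_character _ _ _ hC hB hA).2 fun C₀ h₀ hf => ?_)
  exact hR.symmetry _ _ _ hA hB (mk_lt_of_subset hC h₀) (h C₀ h₀ hf)

end IsIndependenceRelation

/-- Superiority: finite sets are independent from any small set over a finite subset of it. -/
theorem IsSuperior.exists_finite {R : Set M → Set M → Set M → Prop} (h : IsSuperior θ R)
    {A B : Set M} (hA : A.Finite) (hB : #B < θ) : ∃ B₀ ⊆ B, B₀.Finite ∧ R A B₀ B := by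
  let S : Set Cardinal.{u} := {κ | κ.IsRegular ∧ ∀ (n : ℕ) (a : Fin n → M) (B : Set M), #B < θ →
    ∃ B₀ ⊆ B, #B₀ < κ ∧ R (Set.range a) B₀ B}
  have h0 : sInf S = ℵ₀ := h
  -- `κ₀ = ℵ₀` is attained, since the infimum of the empty set of cardinals is `0`.
  have hne : S.Nonempty := by
    by_contra hne
    rw [Set.not_nonempty_iff_eq_empty] at hne
    rw [hne, Cardinal.sInf_empty] at h0
    exact aleph0_ne_zero h0.symm
  have hmem := csInf_mem hne
  rw [h0] at hmem
  obtain ⟨n, a, -, rfl⟩ := hA.fin_param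
  obtain ⟨B₀, h₁, h₂, h₃⟩ := hmem.2 n a B hB
  exact ⟨B₀, h₁, lt_aleph0_iff_set_finite.1 h₂, h₃⟩

/-- `A` is independent over `B` from every small subset of the (possibly large) set `P`. -/
def FreeFrom (θ : Cardinal.{u}) (R : Set M → Set M → Set M → Prop) (A B P : Set M) : Prop :=
  ∀ P' ⊆ P, #P' < θ → R A B P'

theorem freeFrom_of_finite {R : Set M → Set M → Set M → Prop} (hR : IsIndependenceRelation L θ R)
    {A B P : Set M} (hA : #A < θ) (hB : #B < θ) (h : ∀ P' ⊆ P, P'.Finite → R A B P') :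
    FreeFrom θ R A B P := fun _ hP' hs =>
  hR.finite_character_right hA hB hs fun C₀ h₀ hf => h C₀ (h₀.trans hP') hf

/-- Superiority extends to large sets: a chain of finite sets witnessing the contrary would yield
a small set without a finite base. -/
theorem IsSuperior.exists_freeFrom {R : Set M → Set M → Set M → Prop} (hsup : IsSuperior θ R)
    (hR : IsIndependenceRelation L θ R) (hθ : ℵ₀ < θ) {A C : Set M} (hA : A.Finite)
    (hC : #C < θ) (P : Set M) :
    ∃ P₁ ⊆ P, P₁.Finite ∧ FreeFrom θ R A (C ∪ P₁) P := by
  by_contra! hcon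
  have hA' := mk_lt_of_finite hθ hA
  have hstep : ∀ P₁ : {P₁ : Set M // P₁ ⊆ P ∧ P₁.Finite}, ∃ P₂ : {P₁ : Set M // P₁ ⊆ P ∧ P₁.Finite},
      P₁.1 ⊆ P₂.1 ∧ ¬ R A (C ∪ P₁.1) P₂.1 := by
    rintro ⟨P₁, h₁, hf₁⟩
    by_contra! hno
    have hs := mk_union_lt hθ hC (mk_lt_of_finite hθ hf₁)
    refine hcon P₁ h₁ hf₁ (freeFrom_of_finite hR hA' hs fun P' hP' hf' => ?_)
    exact hR.mono_right hA' hs (mk_lt_of_finite hθ (hf₁.union hf'))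
      (hno ⟨P₁ ∪ P', Set.union_subset h₁ hP', hf₁.union hf'⟩ Set.subset_union_left)
      Set.subset_union_right
  choose next hle hnext using hstep
  let c : ℕ → {P₁ : Set M // P₁ ⊆ P ∧ P₁.Finite} := fun n =>
    next^[n] ⟨∅, Set.empty_subset _, Set.finite_empty⟩
  have hc : ∀ n, c (n + 1) = next (c n) := fun n => Function.iterate_succ_apply' _ _ _
  have hmono : Monotone fun n => (c n).1 := monotone_nat_of_le_succ fun n => by
    change (c n).1 ⊆ (c (n + 1)).1
    rw [hc]
    exact hle _
  have hcount : #(⋃ n, (c n).1 : Set M) < θ :=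
    ((Set.countable_iUnion fun n => (c n).2.2.countable).le_aleph0).trans_lt hθ
  have hB := mk_union_lt hθ hC hcount
  obtain ⟨B₀, hB₀, hf₀, hind⟩ := hsup.exists_finite hA hB
  have hex : ∃ n, B₀ ⊆ C ∪ (c n).1 := by
    have : ∀ x ∈ B₀, ∃ n, x ∈ C ∪ (c n).1 := by
      intro x hx
      rcases hB₀ hx with h | h
      · exact ⟨0, Or.inl h⟩
      · obtain ⟨n, hn⟩ := Set.mem_iUnion.1 h
        exact ⟨n, Or.inr hn⟩
    choose! m hm using this
    obtain ⟨N, hN⟩ := (hf₀.image m).bddAbove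
    exact ⟨N, fun x hx => Set.union_subset_union_right C (hmono (hN ⟨x, hx, rfl⟩)) (hm x hx)⟩
  obtain ⟨n, hn⟩ := hex
  apply hnext (c n)
  rw [← hc]
  have hle' : C ∪ (c n).1 ⊆ C ∪ ⋃ n, (c n).1 :=
    Set.union_subset_union_right C (Set.subset_iUnion (fun n => (c n).1) n)
  exact hR.mono_base hθ hA' (mk_lt_of_finite hθ hf₀) hB hind hn
    (hle'.trans Set.subset_union_right)
    (((Set.subset_iUnion (fun n => (c n).1) (n + 1)).trans Set.subset_union_right).trans
      Set.subset_union_right)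

end Calculus

/-! ### Density and extension for finite sets -/

section LovelyMonster

variable {L : FirstOrder.Language.{u, u}} {M : Type u} [L.Structure M] {θ : Cardinal.{u}}
  {R : Set M → Set M → Set M → Prop} {P : Set M}

theorem indepLarge_iff_freeFrom (hR : IsIndependenceRelation L θ R) {A B : Set M} (hA : #A < θ)
    (hB : #B < θ) : IndepLarge θ R A B P ↔ FreeFrom θ R A B P := by
  constructor
  · intro h P' hP' hs
    obtain ⟨B'', h₁, h₂, -, h₃⟩ := h A subset_rfl B subset_rfl P' hP' hA hB hs
    rwa [h₁.antisymm h₂]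
  · intro h A' hA' B' hB' P' hP' _ _ hs
    exact ⟨B, hB', subset_rfl, hB, hR.mono_left hA hB hs (h P' hP' hs) hA'⟩

/-- `(M, P)` regarded as a pair on the largest elementary substructure of `M`. -/
def pairTopEquiv (L : FirstOrder.Language.{u, u}) {M : Type u} [L.Structure M] (P : Set M) :
    subPair (⊤ : L.ElementarySubstructure M) P ≃[L2 L] Pair M P where
  toFun x := (show (⊤ : L.ElementarySubstructure M) from x).1
  invFun x := (⟨x, trivial⟩ : (⊤ : L.ElementarySubstructure M))
  left_inv _ := rfl
  right_inv _ := rfl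
  map_fun' f x := by
    rcases f with f | f
    · rfl
    · exact f.elim
  map_rel' r x := by
    rcases r with r | r
    · rfl
    · cases r
      rfl

theorem IsSaturated.mono {μ ν : Cardinal.{u}} (h : IsSaturated L M ν) (hμ : μ ≤ ν) :
    IsSaturated L M μ := fun A hA => h A (hA.trans_le hμ)

theorem IsSaturated.of_equiv {N : Type u} [L.Structure N] {μ : Cardinal.{u}}
    (h : IsSaturated L M μ) (e : N ≃[L] M) : IsSaturated L N μ := by
  intro A hA n Γ hΓ
  have key : ∀ (ψ : L.Formula (A ⊕ Fin n)) (a : Fin n → N),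
      ψ.Realize (Sum.elim (fun x : A => e x) (e ∘ a)) ↔ (withParams ψ).Realize a := by
    intro ψ a
    rw [realize_withParams, ← StrongHomClass.realize_formula e ψ]
    have : (e ∘ Sum.elim (fun b : A => (b : N)) a) = Sum.elim (fun x : A => e x) (e ∘ a) := by
      ext (i | i) <;> rfl
    rw [this]
  obtain ⟨a, ha⟩ := h.exists_realize hA (fun x : A => e x) {ψ | withParams ψ ∈ Γ} (by
    intro Γ₀ h₀ hf
    obtain ⟨a, ha⟩ := hΓ (withParams '' Γ₀) (by
      rintro _ ⟨ψ, hψ, rfl⟩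
      exact h₀ hψ) (hf.image _)
    exact ⟨e ∘ a, fun ψ hψ => (key ψ a).2 (ha _ ⟨ψ, hψ, rfl⟩)⟩)
  refine ⟨e.symm ∘ a, fun φ hφ => ?_⟩
  obtain ⟨ψ, rfl⟩ := exists_eq_withParams φ
  rw [← key]
  have : e ∘ e.symm ∘ a = a := by
    ext i
    simp
  rw [this]
  exact ha ψ hφ

theorem LovelinessIsFirstOrder.top [Nonempty M] {κ : Cardinal.{u}}
    (hfo : LovelinessIsFirstOrder L θ R κ)
    (hP : IsMonster (L2 L) (Pair M P) θ) (hPd : Pair M P ⊨ lovelyTheory L θ R κ) :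
    DensityProperty L R κ ⊤ P ∧ ExtensionProperty L θ R κ ⊤ P := by
  obtain ⟨μ, hμ, h⟩ := hfo
  refine h ⊤ P (fun _ _ => trivial) ?_ ?_
  · exact StrongHomClass.theory_model (pairTopEquiv L P).symm
  · exact (hP.saturated.mono hμ.le).of_equiv (pairTopEquiv L P)

/-- An automorphism over `D` moving `x` to a realization of `tp(x/D)`. -/
theorem exists_aut_apply_eq [Nonempty M] (hM : IsMonster L M θ) {D : Set M} (hD : #D < θ) {x : M}
    {c : Fin 1 → M} (hc : Realizes c (formulas (tp L D fun _ : Fin 1 => x))) :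
    ∃ σ : M ≃[L] M, (∀ d ∈ D, σ d = d) ∧ σ x = c 0 := by
  obtain ⟨σ, h₁, h₂⟩ := exists_aut_of_tp_eq hM hD (realizes_formulas_iff.1 hc)
  exact ⟨σ, h₁, congrFun h₂ 0⟩

/-- The extension property of lovely pairs, for finite sets instead of elements. -/
theorem ExtensionProperty.exists_aut [Nonempty M] {κ : Cardinal.{u}}
    (hE : ExtensionProperty L θ R κ ⊤ P) (hM : IsMonster L M θ)
    (hR : IsIndependenceRelation L θ R) (hκ : ℵ₀ < κ) {A D : Set M} (hA : A.Finite)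
    (hD : D.Finite) :
    ∃ σ : M ≃[L] M, (∀ d ∈ D, σ d = d) ∧ FreeFrom θ R (σ '' A) D P := by
  have hθ := hM.aleph0_lt
  have hDs := mk_lt_of_finite hθ hD
  induction A, hA using Set.Finite.induction_on with
  | empty =>
    refine ⟨FirstOrder.Language.Equiv.refl L M, fun _ _ => rfl, fun P' _ hs => ?_⟩
    rw [Set.image_empty]
    exact hR.symmetry _ _ _ hs hDs (mk_lt_of_finite hθ Set.finite_empty)
      (hR.mono_right hs hDs hDs (hR.base hs hDs) (Set.empty_subset _))
  | @insert x A _ hA ih =>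
    obtain ⟨σ, hσ, hfree⟩ := ih
    have hE' : (D ∪ σ '' A).Finite := hD.union (hA.image _)
    have hEs := mk_lt_of_finite hθ hE'
    obtain ⟨b, -, hb, hbf⟩ := hE (D ∪ σ '' A) (fun _ _ => trivial) (mk_lt_of_finite hκ hE')
      (tp L (D ∪ σ '' A) fun _ : Fin 1 => σ x)
    obtain ⟨τ, hτ, hτx⟩ := exists_aut_apply_eq hM hEs hb
    rw [indepLarge_iff_freeFrom hR (mk_lt_of_finite hθ (Set.finite_range b)) hEs] at hbf
    refine ⟨τ.comp σ, fun d hd => ?_, fun P' hP' hs => ?_⟩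
    · rw [Equiv.comp_apply, hσ d hd, hτ d (Or.inl hd)]
    · have : (τ.comp σ) '' insert x A = σ '' A ∪ Set.range b := by
        rw [Set.image_insert_eq, Equiv.comp_apply, hτx, Set.union_comm]
        have h1 : Set.range b = {b 0} := by
          ext y
          simp [Fin.exists_fin_one, eq_comm]
        have h2 : (τ.comp σ) '' A = σ '' A := by
          change (fun y => τ (σ y)) '' A = σ '' A
          rw [← Set.image_image (fun y => τ y) (fun y => σ y)]
          exact image_eq_of_fixes τ fun y hy => hτ y (Or.inr hy)
        rw [h1, h2, Set.singleton_union]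
      rw [this]
      exact hR.trans_left hθ (mk_image_lt (mk_lt_of_finite hθ hA) σ) hDs hs
        (mk_lt_of_finite hθ (Set.finite_range b)) (hfree P' hP' hs) (hbf P' hP' hs)

/-- The density property of lovely pairs, for finite sets instead of elements. -/
theorem DensityProperty.exists_aut [Nonempty M] {κ : Cardinal.{u}}
    (hD : DensityProperty L R κ ⊤ P) (hM : IsMonster L M θ)
    (hR : IsIndependenceRelation L θ R) (hκ : ℵ₀ < κ) {A D : Set M} (hA : A.Finite)
    (hDf : D.Finite) (hind : R A (P ∩ D) D) :
    ∃ σ : M ≃[L] M, (∀ d ∈ D, σ d = d) ∧ σ '' A ⊆ P := by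
  have hθ := hM.aleph0_lt
  have hDs := mk_lt_of_finite hθ hDf
  have hPD := mk_lt_of_subset hDs (Set.inter_subset_right (s := P))
  induction A, hA using Set.Finite.induction_on with
  | empty => exact ⟨FirstOrder.Language.Equiv.refl L M, fun _ _ => rfl, by simp⟩
  | @insert x A _ hA ih =>
    have hAs := mk_lt_of_finite hθ hA
    have hxA := mk_lt_of_finite hθ (hA.insert x)
    obtain ⟨σ, hσ, hσP⟩ := ih (hR.mono_left hxA hPD hDs hind (Set.subset_insert x A))
    have hσind : R (σ '' insert x A) (P ∩ D) D := by
      have := hR.invariance _ _ _ hxA hPD hDs σ hind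
      rwa [image_eq_of_fixes σ hσ,
        image_eq_of_fixes σ (B := P ∩ D) fun d hd => hσ d hd.2] at this
    have hσA := mk_image_lt hAs σ
    have hσxA := mk_image_lt hxA σ
    have hE' : (D ∪ σ '' A).Finite := hDf.union (hA.image _)
    have hEs := mk_lt_of_finite hθ hE'
    have hx : #({σ x} : Set M) < θ := mk_lt_of_finite hθ (Set.finite_singleton _)
    have hbase : P ∩ (D ∪ σ '' A) = (P ∩ D) ∪ σ '' A := by
      rw [Set.inter_union_distrib_left, Set.inter_eq_self_of_subset_right hσP]
    have hPDA := mk_union_lt hθ hPD hσA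
    have h1 : R D ((P ∩ D) ∪ σ '' A) {σ x} := by
      refine hR.mono_base hθ hDs hPD hσxA (hR.symmetry _ _ _ hσxA hPD hDs hσind)
        Set.subset_union_left (Set.union_subset_union_right _ ?_) ?_
      · exact Set.image_mono (Set.subset_insert x A)
      · exact Set.singleton_subset_iff.2 (Or.inr ⟨x, Set.mem_insert x A, rfl⟩)
    have h2 : R {σ x} (P ∩ (D ∪ σ '' A)) (D ∪ σ '' A) := by
      rw [hbase]
      refine hR.mono_right hx hPDA (mk_union_lt hθ hPDA hDs)
        (hR.union_base_right hθ hx hPDA hDs (hR.symmetry _ _ _ hDs hPDA hx h1)) ?_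
      exact Set.union_subset Set.subset_union_right
        (Set.subset_union_right.trans Set.subset_union_left)
    obtain ⟨c, hcP, hc⟩ := hD (D ∪ σ '' A) (fun _ _ => trivial) (mk_lt_of_finite hκ hE')
      (tp L (D ∪ σ '' A) fun _ : Fin 1 => σ x)
      ⟨fun _ => σ x, realizes_formulas_iff.2 rfl, by rwa [Set.range_const]⟩
    obtain ⟨τ, hτ, hτx⟩ := exists_aut_apply_eq hM hEs hc
    refine ⟨τ.comp σ, fun d hd => ?_, ?_⟩
    · rw [Equiv.comp_apply, hσ d hd, hτ d (Or.inl hd)]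
    · rintro _ ⟨y, hy, rfl⟩
      rcases hy with rfl | hy
      · rw [Equiv.comp_apply, hτx]
        exact hcP
      · rw [Equiv.comp_apply, hτ _ (Or.inr ⟨y, hy, rfl⟩)]
        exact hσP ⟨y, hy, rfl⟩

end LovelyMonster

/-! ### Existential quantification over `P` -/

section ExistsInP

variable {L : FirstOrder.Language.{u, u}} {M : Type u} [L.Structure M]

variable (L) in
/-- The predicate `P` as a relation symbol of `L²`. -/
def predSymbol : (L2 L).Relations 1 :=
  Sum.inr PredRel.P

/-- The `L`-formula `φ(x, y)` as an `L²`-formula, conjoined with `P(y)`. -/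
noncomputable def inP {α : Type u} {m : ℕ} (φ : L.Formula (α ⊕ Fin m)) :
    (L2 L).Formula (α ⊕ Fin m) :=
  (LHom.sumInl : L →ᴸ L2 L).onFormula φ ⊓ Formula.iInf fun i : Fin m =>
    Relations.formula₁ (predSymbol L) (Term.var (Sum.inr i))

/-- The `L²`-formula `∃ y ∈ P, φ(x, y)`. -/
noncomputable def existsP {α : Type u} {m : ℕ} (φ : L.Formula (α ⊕ Fin m)) : (L2 L).Formula α :=
  Formula.iExs (Fin m) (inP φ)

theorem realize_sumInl {P : Set M} {α : Type u} (φ : L.Formula α) (v : α → Pair M P) :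
    ((LHom.sumInl : L →ᴸ L2 L).onFormula φ).Realize v ↔ φ.Realize (M := M) v :=
  LHom.realize_onFormula (M := Pair M P) (LHom.sumInl : L →ᴸ L2 L) φ

theorem realize_inP {P : Set M} {α : Type u} {m : ℕ} (φ : L.Formula (α ⊕ Fin m))
    (v : α → Pair M P) (y : Fin m → Pair M P) :
    (inP φ).Realize (Sum.elim v y) ↔
      φ.Realize (M := M) (Sum.elim v y) ∧ ∀ i, (y i : M) ∈ P := by
  rw [inP, Formula.realize_inf, realize_sumInl, Formula.realize_iInf]
  refine and_congr_right fun _ => forall_congr' fun i => ?_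
  exact Formula.realize_rel₁

theorem realize_existsP {P : Set M} {α : Type u} {m : ℕ} (φ : L.Formula (α ⊕ Fin m))
    (v : α → Pair M P) : (existsP φ).Realize v ↔
      ∃ y : Fin m → M, (∀ i, y i ∈ P) ∧ φ.Realize (M := M) (Sum.elim v y) := by
  rw [existsP, Formula.realize_iExs]
  exact exists_congr fun y => (realize_inP φ v y).trans and_comm

/-- If the formulas true of `(x', y)` are each satisfied by `x` together with some tuple in `P`,
then saturation of the pair provides one tuple in `P` for all of them. -/
theorem IsSaturated.exists_mem_sameType {P : Set M} {μ : Cardinal.{u}}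
    (h : IsSaturated (L2 L) (Pair M P) μ) {ι : Type u} (hι : #ι < μ) (x x' : ι → M) {m : ℕ}
    (y : Fin m → M)
    (hy : ∀ φ : L.Formula (ι ⊕ Fin m), φ.Realize (Sum.elim x' y) →
      ∃ y' : Fin m → M, (∀ i, y' i ∈ P) ∧ φ.Realize (Sum.elim x y')) :
    ∃ y' : Fin m → M, (∀ i, y' i ∈ P) ∧ SameType L (Sum.elim x' y) (Sum.elim x y') := by
  obtain ⟨y', hy'⟩ := h.exists_realize hι (x : ι → Pair M P)
    (inP '' {φ : L.Formula (ι ⊕ Fin m) | φ.Realize (Sum.elim x' y)}) (by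
      intro Γ₀ h₀ hf
      obtain ⟨s, hs, hsf, rfl⟩ := Set.exists_subset_image_finite_and.1 ⟨Γ₀, h₀, hf, rfl⟩
      have : Finite s := hsf
      obtain ⟨y', h₁, h₂⟩ := hy (Formula.iInf fun φ : s => (φ : L.Formula (ι ⊕ Fin m)))
        (Formula.realize_iInf.2 fun φ => hs φ.2)
      refine ⟨y', ?_⟩
      rintro _ ⟨φ, hφ, rfl⟩
      exact (realize_inP φ _ _).2 ⟨Formula.realize_iInf.1 h₂ ⟨φ, hφ⟩, h₁⟩)
  have key : ∀ φ : L.Formula (ι ⊕ Fin m), φ.Realize (Sum.elim x' y) →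
      φ.Realize (M := M) (Sum.elim x y') ∧ ∀ i, (y' i : M) ∈ P := fun φ hφ =>
    (realize_inP φ _ _).1 (hy' _ ⟨φ, hφ, rfl⟩)
  exact ⟨y', (key ⊤ (Formula.realize_top.2 trivial)).2, sameType_of_imp fun φ hφ => (key φ hφ).1⟩

theorem sameType_joint_of_finite {B : Set M} {n : ℕ} {a b : Fin n → M}
    (h : ∀ D ⊆ B, D.Finite → ∃ D', D ⊆ D' ∧ SameType L (joint D' a) (joint D' b)) :
    SameType L (joint B a) (joint B b) := by
  intro φ
  obtain ⟨s, hs, ψ, hψ⟩ := exists_finite_relabel (M := M) φ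
  obtain ⟨D', hD', hsame⟩ := h (Subtype.val '' s) (by rintro _ ⟨x, -, rfl⟩; exact x.2)
    (hs.image _)
  let f : s ⊕ Fin n → D' ⊕ Fin n := Sum.map (fun x => ⟨x.1, hD' ⟨x.1, x.2, rfl⟩⟩) id
  have hf : ∀ c : Fin n → M, (joint B c ∘ Sum.map (fun a : s => (a : B)) id) = joint D' c ∘ f := by
    intro c
    ext (i | i) <;> rfl
  rw [hψ, hψ, hf, hf, ← Formula.realize_relabel, ← Formula.realize_relabel]
  exact hsame _

end ExistsInP

/-! ### Compactness in the pair -/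

section FreeRealizations

variable {L : FirstOrder.Language.{u, u}} {M : Type u} [L.Structure M] [Nonempty M]
  {θ κ : Cardinal.{u}} {R : Set M → Set M → Set M → Prop} {P : Set M}

omit [Nonempty M] in
theorem FreeFrom.mono_base {A B D : Set M} (h : FreeFrom θ R A B P)
    (hR : IsIndependenceRelation L θ R) (hθ : ℵ₀ < θ) (hA : #A < θ) (hB : #B < θ) (hD : #D < θ)
    (hBD : B ⊆ D) (hDP : D ⊆ B ∪ P) : FreeFrom θ R A D P := by
  intro P' hP' hs
  have hDP' := mk_lt_of_subset hD (Set.inter_subset_left (t := P))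
  refine hR.mono_base hθ hA hB (mk_union_lt hθ hDP' hs)
    (h (D ∩ P ∪ P') (Set.union_subset Set.inter_subset_right hP') (mk_union_lt hθ hDP' hs)) hBD ?_
    (Set.subset_union_right.trans Set.subset_union_right)
  intro x hx
  rcases hDP hx with h1 | h1
  · exact Or.inl h1
  · exact Or.inr (Or.inl ⟨hx, h1⟩)

/-- If `D` is independent from `P` over `P ∩ D` and `A` is independent from `P` over `D`, then the
configuration of `A` with a finite part `E` of `P` is reproduced, inside `P`, over every conjugate
of `A` over `D`. -/
theorem DensityProperty.exists_aut_eqOn (hDen : DensityProperty L R κ ⊤ P) (hM : IsMonster L M θ)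
    (hR : IsIndependenceRelation L θ R) (hκ : ℵ₀ < κ) {A D E : Set M} (hA : A.Finite)
    (hD : D.Finite) (hE : E.Finite) (hEP : E ⊆ P) (hDP : FreeFrom θ R D (P ∩ D) P)
    (hAP : FreeFrom θ R A D P) (τ : M ≃[L] M) (hτ : ∀ d ∈ D, τ d = d) :
    ∃ ρ : M ≃[L] M, (∀ d ∈ D, ρ d = d) ∧ (∀ a ∈ A, ρ a = τ a) ∧ ρ '' E ⊆ P := by
  have hθ := hM.aleph0_lt
  have hAs := mk_lt_of_finite hθ hA
  have hDs := mk_lt_of_finite hθ hD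
  have hEs := mk_lt_of_finite hθ hE
  have hPD := mk_lt_of_subset hDs (Set.inter_subset_right (s := P))
  have hDA := mk_union_lt hθ hDs hAs
  have h1 : R E (P ∩ D) (D ∪ A) := by
    refine hR.symmetry _ _ _ hDA hPD hEs (hR.trans_left hθ hDs hPD hEs hAs (hDP E hEP hEs) ?_)
    rw [Set.union_eq_self_of_subset_left Set.inter_subset_right]
    exact hAP E hEP hEs
  have h2 := hR.invariance _ _ _ hEs hPD hDA τ h1
  have hτD : τ '' (D ∪ A) = D ∪ τ '' A := by rw [Set.image_union, image_eq_of_fixes τ hτ]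
  rw [image_eq_of_fixes τ (B := P ∩ D) fun d hd => hτ d hd.2, hτD] at h2
  have hfin : (D ∪ τ '' A).Finite := hD.union (hA.image _)
  have h3 : R (τ '' E) (P ∩ (D ∪ τ '' A)) (D ∪ τ '' A) :=
    hR.mono_base hθ (mk_image_lt hEs τ) hPD (mk_lt_of_finite hθ hfin) h2
      (Set.inter_subset_inter_right P Set.subset_union_left)
      (Set.inter_subset_right.trans Set.subset_union_right) Set.subset_union_right
  obtain ⟨ν, hν, hνP⟩ := hDen.exists_aut hM hR hκ (hE.image τ) hfin h3
  refine ⟨ν.comp τ, fun d hd => ?_, fun a ha => ?_, ?_⟩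
  · rw [Equiv.comp_apply, hτ d hd, hν d (Or.inl hd)]
  · rw [Equiv.comp_apply, hν _ (Or.inr ⟨a, ha, rfl⟩)]
  · rintro _ ⟨e, he, rfl⟩
    exact hνP ⟨τ e, ⟨e, he, rfl⟩, rfl⟩

/-- `D` is a finite part of `B` that contains `B₀` and is independent from `P` over its
intersection with `P`. -/
structure IsFreePart (θ : Cardinal.{u}) (R : Set M → Set M → Set M → Prop) (P B₀ B D : Set M) :
    Prop where
  subset : D ⊆ B
  finite : D.Finite
  base_subset : B₀ ⊆ D
  free : FreeFrom θ R D (P ∩ D) P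

/-- `b` is conjugate to `c` over `D` and independent from `P` over `D`. -/
def IsFreeConj (L : FirstOrder.Language.{u, u}) [L.Structure M] (θ : Cardinal.{u})
    (R : Set M → Set M → Set M → Prop) (P D : Set M) {n : ℕ} (c b : Fin n → M) : Prop :=
  (∃ σ : M ≃[L] M, (∀ d ∈ D, σ d = d) ∧ b = σ ∘ c) ∧ FreeFrom θ R (Set.range b) D P

/-- Compactness in the pair: there is a tuple whose `P`-existential `L`-type over each free part
`D` of `B` is that of the conjugates of `c` over `D` that are independent from `P` over `D`. -/
theorem exists_forall_isFreeConj (hM : IsMonster L M θ) (hR : IsIndependenceRelation L θ R)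
    (hP : IsMonster (L2 L) (Pair M P) θ) (hDen : DensityProperty L R κ ⊤ P)
    (hExt : ExtensionProperty L θ R κ ⊤ P) (hκ : ℵ₀ < κ)
    {n : ℕ} (c : Fin n → M) {B₀ B : Set M} (hB : #B < θ)
    (hc : R (Set.range c) B₀ B)
    (hfree : ∀ D ⊆ B, D.Finite → ∃ D', D ⊆ D' ∧ IsFreePart θ R P B₀ B D') :
    ∃ c' : Fin n → M, ∀ D, IsFreePart θ R P B₀ B D → ∀ (m : ℕ) (p : Fin m → M), (∀ i, p i ∈ P) →
      ∃ (b : Fin n → M) (p' : Fin m → M), IsFreeConj L θ R P D c b ∧ (∀ i, p' i ∈ P) ∧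
        SameType L (Sum.elim (joint D c') p) (Sum.elim (joint D b) p') := by
  have hθ := hM.aleph0_lt
  have hcs : #(Set.range c) < θ := mk_lt_of_finite hθ (Set.finite_range c)
  have hexists : ∀ D, IsFreePart θ R P B₀ B D → ∃ b, IsFreeConj L θ R P D c b := by
    intro D hD
    obtain ⟨σ, h₁, h₂⟩ := hExt.exists_aut hM hR hκ (Set.finite_range c) hD.finite
    exact ⟨σ ∘ c, ⟨σ, h₁, rfl⟩, by rwa [Set.range_comp]⟩
  -- The formulas `¬ ∃ y ∈ P, φ(x, y)` over a free part `D` that hold of some free conjugate over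
  -- `D`. For empty `y` these include the negations of all `L`-formulas over `D` false of `c`.
  let Γ : Set ((L2 L).Formula (B ⊕ Fin n)) :=
    {ψ | ∃ (D : Set M) (hD : IsFreePart θ R P B₀ B D) (m : ℕ)
      (φ : L.Formula ((D ⊕ Fin n) ⊕ Fin m)) (b : Fin n → M), IsFreeConj L θ R P D c b ∧
      ¬ (existsP φ).Realize (M := Pair M P) (joint D b) ∧
      ψ = (existsP φ).not.relabel (Sum.map (Set.inclusion hD.subset) id)}
  have hreal : ∀ (D : Set M) (hD : D ⊆ B) (χ : (L2 L).Formula (D ⊕ Fin n)) (a : Fin n → M),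
      (χ.not.relabel (Sum.map (Set.inclusion hD) id)).Realize (M := Pair M P) (joint B a) ↔
        ¬ χ.Realize (M := Pair M P) (joint D a) := by
    intro D hD χ a
    have hj : joint B a ∘ Sum.map (Set.inclusion hD) id = joint D a := by
      ext (i | i) <;> rfl
    exact Formula.realize_relabel.trans
      (Iff.of_eq (congrArg (fun v : D ⊕ Fin n → M => ¬ χ.Realize (M := Pair M P) v) hj))
  obtain ⟨c', hc'⟩ := hP.saturated.exists_realize (M := Pair M P) hB
    (fun x : B => (x : M)) Γ (by
    intro Γ₀ h₀ hf
    -- A formula of `Γ` that comes from `D` holds of the free conjugates over each larger free part.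
    have h₀' : ∀ ψ : Γ₀, ∃ D, IsFreePart θ R P B₀ B D ∧
        ∀ D', IsFreePart θ R P B₀ B D' → D ⊆ D' → ∀ b, IsFreeConj L θ R P D' c b →
          (ψ : (L2 L).Formula (B ⊕ Fin n)).Realize (M := Pair M P) (joint B b) := by
      rintro ⟨ψ, hψ⟩
      obtain ⟨D, hD, m, φ, b₁, ⟨⟨σ₁, hσ₁, hb₁⟩, -⟩, hφ, rfl⟩ := h₀ hψ
      refine ⟨D, hD, fun D' hD' hDD' b hb => (hreal D hD.subset _ b).2 fun hcon => hφ ?_⟩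
      obtain ⟨p, hpP, hp⟩ := (realize_existsP φ _).1 hcon
      obtain ⟨⟨σ, hσ, rfl⟩, hbP⟩ := hb
      have hDs := mk_lt_of_finite hθ hD.finite
      have hDs' := mk_lt_of_finite hθ hD'.finite
      have hB₀ := mk_lt_of_subset hDs hD.base_subset
      have hbs : #(Set.range (σ ∘ c)) < θ := mk_lt_of_finite hθ (Set.finite_range _)
      have hbD' : R (Set.range (σ ∘ c)) B₀ D' := by
        have := hR.invariance _ _ _ hcs hB₀ hDs' σ (hR.mono_right hcs hB₀ hB hc hD'.subset)
        rwa [image_eq_of_fixes σ (B := D') hσ, image_eq_of_fixes σ (B := B₀) fun d hd =>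
          hσ d (hD'.base_subset hd), ← Set.range_comp] at this
      -- Independence from `P` descends from `D'` to `D`, because both contain the base `B₀`.
      have hbD : FreeFrom θ R (Set.range (σ ∘ c)) D P := by
        intro P' hP' hs
        refine hR.mono_base hθ hbs hB₀ (mk_union_lt hθ hDs' hs) (hR.trans_right hθ hbs hB₀ hDs' hs
          hbD' ?_) hD.base_subset
          ((hDD'.trans Set.subset_union_left).trans Set.subset_union_right)
          (Set.subset_union_right.trans Set.subset_union_right)
        rw [Set.union_eq_self_of_subset_left hD'.base_subset]
        exact hbP P' hP' hs
      obtain ⟨ρ, hρD, hρb, hρP⟩ := hDen.exists_aut_eqOn hM hR hκ (Set.finite_range (σ ∘ c))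
        hD.finite (Set.finite_range p) (by rintro _ ⟨i, rfl⟩; exact hpP i) hD.free hbD
        (σ₁.comp σ.symm) (fun d hd => by
          rw [Equiv.comp_apply]
          have : σ.symm d = d := by
            conv_lhs => rw [← hσ d (hDD' hd)]
            exact σ.symm_apply_apply d
          rw [this, hσ₁ d hd])
      refine (realize_existsP φ _).2 ⟨ρ ∘ p, fun i => hρP ⟨p i, ⟨i, rfl⟩, rfl⟩, ?_⟩
      have heq : Sum.elim (joint D b₁) (ρ ∘ p) = ρ ∘ Sum.elim (joint D (σ ∘ c)) p := by
        ext ((i | i) | i)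
        · exact (hρD i i.2).symm
        · have := hρb _ ⟨i, rfl⟩
          rw [hb₁]
          exact (this.trans (congrArg σ₁ (σ.symm_apply_apply (c i)))).symm
        · rfl
      exact (by rw [heq]; exact (StrongHomClass.realize_formula ρ φ).2 hp :
        φ.Realize (M := M) (Sum.elim (joint D b₁) (ρ ∘ p)))
    choose D hD hDψ using h₀'
    have : Finite Γ₀ := hf
    obtain ⟨D', hD', hfp⟩ := hfree (⋃ ψ, D ψ) (Set.iUnion_subset fun ψ => (hD ψ).subset)
      (Set.finite_iUnion fun ψ => (hD ψ).finite)
    obtain ⟨b, hb⟩ := hexists D' hfp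
    exact ⟨b, fun ψ hψ => hDψ ⟨ψ, hψ⟩ D' hfp ((Set.subset_iUnion D _).trans hD') b hb⟩)
  refine ⟨c', fun D hD m p hp => ?_⟩
  obtain ⟨b, hb⟩ := hexists D hD
  obtain ⟨p', hp', hsame⟩ := hP.saturated.exists_mem_sameType (ι := D ⊕ Fin n) (by
      rw [mk_sum]
      refine add_lt_of_lt hθ.le (by rw [lift_uzero]; exact mk_lt_of_finite hθ hD.finite) ?_
      exact (lift_lt_aleph0.2 (lt_aleph0_of_finite _)).trans hθ)
    (joint D b) (joint D c') p (fun φ hφ => by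
      by_contra hcon
      exact (hreal D hD.subset (existsP φ) c').1
        (hc' _ ⟨D, hD, m, φ, b, hb, fun h => hcon ((realize_existsP φ _).1 h), rfl⟩)
        ((realize_existsP φ _).2 ⟨p, hp, hφ⟩))
  exact ⟨b, p', hb, hp', hsame⟩

end FreeRealizations

/-! ### The extension property over small sets -/

section ExtensionSmall

variable {L : FirstOrder.Language.{u, u}} {M : Type u} [L.Structure M] [Nonempty M]
  {θ κ : Cardinal.{u}} {R : Set M → Set M → Set M → Prop} {P : Set M}

/-- If `B` is exhausted by its free parts, then some conjugate of `c` over `B` is independent from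
`P` over `B`. -/
theorem exists_aut_freeFrom_of_free_parts (hM : IsMonster L M θ)
    (hR : IsIndependenceRelation L θ R) (hsup : IsSuperior θ R)
    (hP : IsMonster (L2 L) (Pair M P) θ) (hDen : DensityProperty L R κ ⊤ P)
    (hExt : ExtensionProperty L θ R κ ⊤ P) (hκ : ℵ₀ < κ)
    {n : ℕ} (c : Fin n → M) {B₀ B : Set M} (hB : #B < θ)
    (hc : R (Set.range c) B₀ B)
    (hfree : ∀ D ⊆ B, D.Finite → ∃ D', D ⊆ D' ∧ IsFreePart θ R P B₀ B D') :
    ∃ σ : M ≃[L] M, (∀ b ∈ B, σ b = b) ∧ FreeFrom θ R (Set.range (σ ∘ c)) B P := by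
  have hθ := hM.aleph0_lt
  obtain ⟨c', hc'⟩ := exists_forall_isFreeConj hM hR hP hDen hExt hκ c hB hc hfree
  -- The case of an empty tuple in `P` says that `c'` and `c` have the same `L`-type over `B`.
  have htp : tp L B c = tp L B c' := by
    refine tp_eq_iff.2 (sameType_joint_of_finite fun D hD hf => ?_)
    obtain ⟨D', hDD', hD'⟩ := hfree D hD hf
    obtain ⟨b, p', ⟨⟨σ, hσ, rfl⟩, -⟩, -, hsame⟩ := hc' D' hD' 0 Fin.elim0 fun i => i.elim0
    refine ⟨D', hDD', fun φ => ?_⟩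
    have h1 := hsame (φ.relabel Sum.inl)
    rw [Formula.realize_relabel, Formula.realize_relabel, Sum.elim_comp_inl,
      Sum.elim_comp_inl] at h1
    rw [h1]
    exact tp_eq_iff.1 (tp_comp_aut c σ hσ).symm φ
  obtain ⟨σ, hσ, rfl⟩ := exists_aut_of_tp_eq hM hB htp
  refine ⟨σ, hσ, ?_⟩
  have hbs : #(Set.range (σ ∘ c)) < θ := mk_lt_of_finite hθ (Set.finite_range _)
  refine freeFrom_of_finite hR hbs hB fun P' hP' hf => ?_
  obtain ⟨m, p, -, rfl⟩ := hf.fin_param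
  have hps := mk_lt_of_finite hθ hf
  have hXf : (Set.range (σ ∘ c) ∪ Set.range p).Finite := (Set.finite_range _).union hf
  have hXs := mk_lt_of_finite hθ hXf
  obtain ⟨D₀, hD₀, hf₀, hind⟩ := hsup.exists_finite hXf hB
  obtain ⟨D, hD₀D, hD⟩ := hfree D₀ hD₀ hf₀
  have hDs := mk_lt_of_finite hθ hD.finite
  have hind' := hR.mono_base hθ hXs (mk_lt_of_finite hθ hf₀) hB hind hD₀D
    (hD.subset.trans Set.subset_union_right) Set.subset_union_right
  obtain ⟨b, p', ⟨-, hbP⟩, hp'P, hsame⟩ := hc' D hD m p fun i => hP' ⟨i, rfl⟩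
  obtain ⟨ν, hν⟩ := hM.homogeneous.exists_aut (by
    rw [mk_sum, mk_sum]
    have hn : ∀ k : ℕ, lift.{u} #(Fin k) < θ := fun k =>
      (lift_lt_aleph0.2 (lt_aleph0_of_finite _)).trans hθ
    refine add_lt_of_lt hθ.le ?_ (hn m)
    rw [lift_uzero]
    exact add_lt_of_lt hθ.le (by rwa [lift_uzero]) (hn n)) hsame
  have hνD : ν '' D = D := image_eq_of_fixes ν fun d hd => hν (Sum.inl (Sum.inl ⟨d, hd⟩))
  have hνb : ν '' Set.range (σ ∘ c) = Set.range b := by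
    rw [← Set.range_comp]
    exact congrArg Set.range (funext fun i => hν (Sum.inl (Sum.inr i)))
  have hνp : ν '' Set.range p = Set.range p' := by
    rw [← Set.range_comp]
    exact congrArg Set.range (funext fun i => hν (Sum.inr i))
  have h1 : R (Set.range (σ ∘ c)) D (Set.range p) := by
    rw [← hR.aut_iff hbs hDs hps ν, hνD, hνb, hνp]
    exact hbP _ (by rintro _ ⟨i, rfl⟩; exact hp'P i) (mk_lt_of_finite hθ (Set.finite_range p'))
  have h2 : R (Set.range (σ ∘ c)) (D ∪ Set.range p) B :=
    hR.symmetry _ _ _ hB (mk_union_lt hθ hDs hps) hbs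
      (hR.mono_base hθ hB hDs hXs (hR.symmetry _ _ _ hXs hDs hB hind') Set.subset_union_left
        (Set.union_subset_union_right D Set.subset_union_right)
        (Set.subset_union_left.trans Set.subset_union_right))
  exact hR.mono_base hθ hbs hDs (mk_union_lt hθ hps hB) (hR.trans_right hθ hbs hDs hps hB h1 h2)
    hD.subset (Set.subset_union_right.trans Set.subset_union_right)
    (Set.subset_union_left.trans Set.subset_union_right)

omit [Nonempty M] in
/-- There is a small part of `P` over which every finite subset of `B` is independent from `P`,
each already over a finite subset. -/
theorem exists_small_bases (hR : IsIndependenceRelation L θ R) (hsup : IsSuperior θ R)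
    (hθ : ℵ₀ < θ) {B : Set M} (hB : #B < θ) (P : Set M) :
    ∃ P₁ ⊆ P, #P₁ < θ ∧ ∀ D ⊆ B, D.Finite →
      ∃ E ⊆ P₁, E.Finite ∧ FreeFrom θ R D E P := by
  have h : ∀ l : List B, ∃ E ⊆ P, E.Finite ∧ FreeFrom θ R (Subtype.val '' {x | x ∈ l}) E P := by
    intro l
    obtain ⟨E, h₁, h₂, h₃⟩ := hsup.exists_freeFrom hR hθ (C := ∅)
      (A := Subtype.val '' {x | x ∈ l}) (l.finite_toSet.image _)
      (mk_lt_of_finite hθ Set.finite_empty) P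
    exact ⟨E, h₁, h₂, by rwa [Set.empty_union] at h₃⟩
  -- Lists over `B` index its finite subsets, with fewer than `θ` indices.
  choose E hEP hEf hE using h
  refine ⟨⋃ l, E l, Set.iUnion_subset hEP, ?_, fun D hD hf => ?_⟩
  · refine (mk_iUnion_le E).trans_lt (mul_lt_of_lt hθ.le ?_ ?_)
    · exact (mk_list_le_max B).trans_lt (max_lt hθ hB)
    · exact (ciSup_le' fun l => (hEf l).lt_aleph0.le).trans_lt hθ
  · obtain ⟨l, hl⟩ := (hf.preimage (Subtype.val_injective (p := (· ∈ B))).injOn).exists_finset_coe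
    have : Subtype.val '' {x | x ∈ l.toList} = D := by
      have h1 : {x | x ∈ l.toList} = (Subtype.val ⁻¹' D : Set B) := by
        rw [← hl]
        ext x
        simp
      rw [h1, Subtype.image_preimage_coe, Set.inter_eq_self_of_subset_right hD]
    exact ⟨E l.toList, Set.subset_iUnion E _, hEf _, this ▸ hE l.toList⟩

/-- The extension property over arbitrary small sets: every finite tuple has a conjugate over `B`
that is independent from `P` over `B`. -/
theorem exists_aut_freeFrom (hM : IsMonster L M θ)
    (hR : IsIndependenceRelation L θ R) (hsup : IsSuperior θ R)
    (hP : IsMonster (L2 L) (Pair M P) θ) (hDen : DensityProperty L R κ ⊤ P)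
    (hExt : ExtensionProperty L θ R κ ⊤ P) (hκ : ℵ₀ < κ)
    {n : ℕ} (c : Fin n → M) {B : Set M} (hB : #B < θ) :
    ∃ σ : M ≃[L] M, (∀ b ∈ B, σ b = b) ∧ FreeFrom θ R (Set.range (σ ∘ c)) B P := by
  have hθ := hM.aleph0_lt
  obtain ⟨P₁, hP₁P, hP₁, hbases⟩ := exists_small_bases hR hsup hθ hB P
  have hBP₁ := mk_union_lt hθ hB hP₁
  have hs : ∀ a : Fin n → M, #(Set.range a) < θ := fun a =>
    mk_lt_of_finite hθ (Set.finite_range a)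
  -- Independence from `P₁` over `B` makes it enough to obtain independence from `P` over `B ∪ P₁`,
  -- and each finite subset of `B ∪ P₁` lies in one that is independent from `P` over its
  -- intersection with `P`.
  obtain ⟨σ₁, hσ₁, hind₁⟩ := hR.extension (Set.range c) B P₁ (hs c) hB hP₁
  rw [← Set.range_comp] at hind₁
  obtain ⟨B₀, hB₀, hf₀, hind₀⟩ := hsup.exists_finite (Set.finite_range (σ₁ ∘ c)) hB
  have hB₀s := mk_lt_of_finite hθ hf₀
  have hind : R (Set.range (σ₁ ∘ c)) B₀ (B ∪ P₁) := by
    refine hR.trans_right hθ (hs _) hB₀s hB hP₁ hind₀ ?_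
    rwa [Set.union_eq_self_of_subset_left hB₀]
  obtain ⟨σ₂, hσ₂, hfree⟩ := exists_aut_freeFrom_of_free_parts hM hR hsup hP hDen hExt hκ
    (σ₁ ∘ c) hBP₁ hind (fun D hD hf => by
      obtain ⟨E, hE, hEf, hEfree⟩ := hbases ((D ∪ B₀) ∩ B) Set.inter_subset_right
        ((hf.union hf₀).inter_of_left B)
      have hfin : (D ∪ B₀ ∪ E).Finite := (hf.union hf₀).union hEf
      have hD's := mk_lt_of_finite hθ hfin
      have hPD' := mk_lt_of_subset hD's (Set.inter_subset_right (s := P))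
      have hAs : #((D ∪ B₀) ∩ B : Set M) < θ :=
        mk_lt_of_finite hθ ((hf.union hf₀).inter_of_left B)
      have hbig := hEfree.mono_base hR hθ hAs (mk_lt_of_finite hθ hEf) hPD'
        (Set.subset_inter (hE.trans hP₁P) Set.subset_union_right)
        (Set.inter_subset_left.trans Set.subset_union_right)
      refine ⟨D ∪ B₀ ∪ E, Set.subset_union_left.trans Set.subset_union_left, ?_, hfin,
        Set.subset_union_right.trans Set.subset_union_left, fun P' hP' hs' => ?_⟩
      · exact Set.union_subset (Set.union_subset hD (hB₀.trans Set.subset_union_left))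
          (hE.trans Set.subset_union_right)
      · refine hR.mono_left (mk_union_lt hθ hPD' hAs) hPD' hs'
          (hR.union_base_left hAs hPD' hs' (hbig P' hP' hs')) ?_
        rintro x (hx | hx)
        · have hx' : x ∈ B ∪ P₁ := by
            rcases hx with h | h
            · exact hD h
            · exact Or.inl (hB₀ h)
          rcases hx' with h | h
          · exact Or.inr ⟨hx, h⟩
          · exact Or.inl ⟨hP₁P h, Or.inl hx⟩
        · exact Or.inl ⟨hP₁P (hE hx), Or.inr hx⟩)
  refine ⟨σ₂.comp σ₁, fun b hb => ?_, fun P' hP' hs' => ?_⟩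
  · rw [Equiv.comp_apply, hσ₁ b hb, hσ₂ b (Or.inl hb)]
  · have h1 : R (Set.range (σ₂ ∘ σ₁ ∘ c)) B P₁ := by
      have := hR.invariance _ _ _ (hs _) hB hP₁ σ₂ hind₁
      rwa [← Set.range_comp, image_eq_of_fixes σ₂ (B := B) fun b hb => hσ₂ b (Or.inl hb),
        image_eq_of_fixes σ₂ (B := P₁) fun b hb => hσ₂ b (Or.inr hb)] at this
    exact hR.mono_right (hs _) hB (mk_union_lt hθ hP₁ hs')
      (hR.trans_right hθ (hs _) hB hP₁ hs' h1 (hfree P' hP' hs')) Set.subset_union_right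

end ExtensionSmall

/-! ### Ranks in a monster model -/

section Rank

variable {L : FirstOrder.Language.{u, u}} {M : Type u} [L.Structure M] {θ : Cardinal.{u}}
  {R : Set M → Set M → Set M → Prop}

/-- The relation `R` on small sets is invariant under automorphisms. -/
def IsInvariant (L : FirstOrder.Language.{u, u}) {M : Type u} [L.Structure M] (θ : Cardinal.{u})
    (R : Set M → Set M → Set M → Prop) : Prop :=
  ∀ A B C : Set M, #A < θ → #B < θ → #C < θ → ∀ σ : M ≃[L] M,
    R A B C → R (σ '' A) (σ '' B) (σ '' C)

theorem IsInvariant.iff (hR : IsInvariant L θ R) {A B C : Set M} (hA : #A < θ) (hB : #B < θ)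
    (hC : #C < θ) (σ : M ≃[L] M) : R (σ '' A) (σ '' B) (σ '' C) ↔ R A B C := by
  refine ⟨fun h => ?_, hR A B C hA hB hC σ⟩
  have := hR _ _ _ (mk_image_lt hA σ) (mk_image_lt hB σ) (mk_image_lt hC σ) σ.symm h
  simpa only [image_symm_image] using this

variable [Nonempty M]

omit [Nonempty M] in
theorem mk_range_fin_lt (hθ : ℵ₀ < θ) {n : ℕ} (a : Fin n → M) : #(Set.range a) < θ :=
  mk_lt_of_finite hθ (Set.finite_range a)

theorem typeIndep_tp_iff (hM : IsMonster L M θ) (hR : IsInvariant L θ R) {B C : Set M}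
    (hBC : B ⊆ C) (hC : #C < θ) {n : ℕ} (a : Fin n → M) :
    TypeIndep R (tp L C a) B C ↔ R (Set.range a) B C := by
  refine ⟨?_, fun h => ⟨a, realizes_formulas_iff.2 rfl, h⟩⟩
  rintro ⟨b, hb, hind⟩
  obtain ⟨σ, hσ, rfl⟩ := exists_aut_of_tp_eq hM hC (realizes_formulas_iff.1 hb)
  rw [← hR.iff (mk_range_fin_lt hM.aleph0_lt a) (mk_lt_of_subset hC hBC) hC σ,
    image_eq_of_fixes σ (B := B) fun b h => hσ b (hBC h), image_eq_of_fixes σ hσ,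
    ← Set.range_comp]
  exact hind

omit [Nonempty M] in
theorem rankGE_iff {n : ℕ} {α : Ordinal.{u}} {B : Set M} {p : TypeOver L M B n} :
    RankGE θ R α p ↔ ∀ β < α, ∃ (C : Set M) (h : B ⊆ C) (q : TypeOver L M C n),
      #C < θ ∧ IsForkingExtension R h q p ∧ RankGE θ R β q := by
  rw [RankGE]

theorem RankGE.aut (hM : IsMonster L M θ) (hR : IsInvariant L θ R) {n : ℕ} {α : Ordinal.{u}}
    {B B' : Set M} (hB : #B < θ) {a a' : Fin n → M} (h : RankGE θ R α (tp L B a))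
    (σ : M ≃[L] M) (hB' : σ '' B = B') (ha' : σ ∘ a = a') : RankGE θ R α (tp L B' a') := by
  subst hB' ha'
  induction α using WellFoundedLT.induction generalizing B a with
  | _ α ih =>
    rw [rankGE_iff] at h ⊢
    intro β hβ
    obtain ⟨C, hBC, q, hC, ⟨hext, hfork⟩, hrank⟩ := h β hβ
    obtain ⟨b, rfl⟩ := hM.saturated.exists_eq_tp hC q
    rw [extends_tp_iff] at hext
    obtain ⟨τ, hτ, rfl⟩ := exists_aut_of_tp_eq hM hB hext
    have hσC := mk_image_lt hC σ
    refine ⟨σ '' C, Set.image_mono hBC, tp L (σ '' C) (σ ∘ τ ∘ a), hσC, ⟨?_, ?_⟩,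
      ih β hβ hC hrank⟩
    · rw [extends_tp_iff]
      have h1 : ((σ.comp τ).comp σ.symm) ∘ (σ ∘ a) = σ ∘ τ ∘ a := by
        ext i
        simp
      rw [← h1]
      refine (tp_comp_aut (σ ∘ a) _ ?_).symm
      rintro _ ⟨x, hx, rfl⟩
      simp [hτ x hx]
    · rw [typeIndep_tp_iff hM hR (Set.image_mono hBC) hσC, Set.range_comp,
        hR.iff (mk_range_fin_lt hM.aleph0_lt _) hB hC]
      rwa [typeIndep_tp_iff hM hR hBC hC] at hfork

/-- By homogeneity, the rank of the type of `a` can be computed by varying only the set of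
parameters. -/
theorem rankGE_tp_iff (hM : IsMonster L M θ) (hR : IsInvariant L θ R) {n : ℕ} {α : Ordinal.{u}}
    {B : Set M} (hB : #B < θ) {a : Fin n → M} :
    RankGE θ R α (tp L B a) ↔ ∀ β < α, ∃ C, B ⊆ C ∧ #C < θ ∧ ¬ R (Set.range a) B C ∧
      RankGE θ R β (tp L C a) := by
  rw [rankGE_iff]
  refine forall₂_congr fun β _ => ⟨?_, ?_⟩
  · rintro ⟨C, hBC, q, hC, ⟨hext, hfork⟩, hrank⟩
    obtain ⟨b, rfl⟩ := hM.saturated.exists_eq_tp hC q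
    rw [extends_tp_iff] at hext
    obtain ⟨σ, hσ, rfl⟩ := exists_aut_of_tp_eq hM hB hext.symm
    have hσB := image_eq_of_fixes σ hσ
    refine ⟨σ '' C, ?_, mk_image_lt hC σ, ?_, hrank.aut hM hR hC σ rfl rfl⟩
    · rw [← hσB]
      exact Set.image_mono hBC
    · rw [typeIndep_tp_iff hM hR hBC hC, ← hR.iff (mk_range_fin_lt hM.aleph0_lt _) hB hC σ,
        hσB, ← Set.range_comp] at hfork
      exact hfork
  · rintro ⟨C, hBC, hC, hfork, hrank⟩
    exact ⟨C, hBC, tp L C a, hC, ⟨(extends_tp_iff hBC).2 rfl,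
      fun h => hfork ((typeIndep_tp_iff hM hR hBC hC a).1 h)⟩, hrank⟩

omit [Nonempty M] in
theorem IsIndependenceRelation.isInvariant (hR : IsIndependenceRelation L θ R) :
    IsInvariant L θ R := hR.invariance

theorem RankGE.mono_base (hM : IsMonster L M θ) (hR : IsIndependenceRelation L θ R) {n : ℕ}
    {α : Ordinal.{u}} {B B' : Set M} (hB' : #B' < θ) (hBB' : B ⊆ B') {a : Fin n → M}
    (h : RankGE θ R α (tp L B' a)) : RankGE θ R α (tp L B a) := by
  have hB := mk_lt_of_subset hB' hBB'
  rw [rankGE_tp_iff hM hR.isInvariant hB'] at h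
  rw [rankGE_tp_iff hM hR.isInvariant hB]
  intro β hβ
  obtain ⟨C, hC, hCs, hfork, hrank⟩ := h β hβ
  exact ⟨C, hBB'.trans hC, hCs, fun hind => hfork (hR.mono_base hM.aleph0_lt
    (mk_range_fin_lt hM.aleph0_lt a) hB hCs hind hBB' (hC.trans Set.subset_union_right)
    Set.subset_union_right), hrank⟩

end Rank

/-! ### Ranks in the pair -/

section PairRank

variable {L : FirstOrder.Language.{u, u}} {M : Type u} [L.Structure M]
  {θ κ : Cardinal.{u}} {R : Set M → Set M → Set M → Prop} {P : Set M}

/-- An automorphism of the pair, viewed as an automorphism of its `L`-reduct. -/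
def reductAut (σ : Pair M P ≃[L2 L] Pair M P) : M ≃[L] M where
  toEquiv := σ.toEquiv
  map_fun' f x := σ.map_fun' (Sum.inl f) x
  map_rel' r x := σ.map_rel' (Sum.inl r) x

theorem reductAut_mem_iff (σ : Pair M P ≃[L2 L] Pair M P) (x : M) :
    reductAut σ x ∈ P ↔ x ∈ P :=
  σ.map_rel' (predSymbol L) ![x]

theorem reductAut_image (σ : Pair M P ≃[L2 L] Pair M P) : reductAut σ '' P = P := by
  ext y
  constructor
  · rintro ⟨x, hx, rfl⟩
    exact (reductAut_mem_iff σ x).2 hx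
  · intro hy
    obtain ⟨x, rfl⟩ := (reductAut σ).surjective y
    exact ⟨x, (reductAut_mem_iff σ x).1 hy, rfl⟩

theorem IndepLarge.image (hR : IsIndependenceRelation L θ R) {A B C : Set M}
    (h : IndepLarge θ R A B C) (σ : M ≃[L] M) :
    IndepLarge θ R (σ '' A) (σ '' B) (σ '' C) := by
  intro A' hA' B' hB' C' hC' hA hB hC
  have hpre : ∀ {X Y : Set M}, X ⊆ σ '' Y → σ.symm '' X ⊆ Y := by
    intro X Y hXY
    rw [← image_symm_image σ Y]
    exact Set.image_mono hXY
  obtain ⟨B'', h₁, h₂, h₃, h₄⟩ := h _ (hpre hA') _ (hpre hB') _ (hpre hC')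
    (mk_image_lt hA _) (mk_image_lt hB _) (mk_image_lt hC _)
  refine ⟨σ '' B'', ?_, Set.image_mono h₂, mk_image_lt h₃ _, ?_⟩
  · rw [← image_image_symm σ B']
    exact Set.image_mono h₁
  · have := hR.invariance _ _ _ (mk_image_lt hA _) h₃ (mk_image_lt hC _) σ h₄
    rwa [image_image_symm, image_image_symm] at this

theorem isInvariant_indepP (hR : IsIndependenceRelation L θ R) :
    IsInvariant (L2 L) (M := Pair M P) θ (indepP θ R P) := by
  intro A B C _ _ _ σ h
  have key : ∀ A B C : Set M, IndepLarge θ R A (B ∪ P) C →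
      IndepLarge θ R (reductAut σ '' A) (reductAut σ '' B ∪ P) (reductAut σ '' C) := by
    intro A B C h
    have := h.image hR (reductAut σ)
    rwa [Set.image_union, reductAut_image] at this
  exact key A B C h

variable [Nonempty M]

/-- A tuple independent from `P` over `B` does not lose rank in the pair. A forking extension by a
finite tuple `c` survives in the pair when `c` is independent from `P` over `B` and `a`, and `c` has
such a conjugate. -/
theorem RankGE.pair_of_freeFrom (hM : IsMonster L M θ)
    (hR : IsIndependenceRelation L θ R) (hsup : IsSuperior θ R)
    (hP : IsMonster (L2 L) (Pair M P) θ) (hDen : DensityProperty L R κ ⊤ P)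
    (hExt : ExtensionProperty L θ R κ ⊤ P) (hκ : ℵ₀ < κ) {n : ℕ} {α : Ordinal.{u}} {B : Set M}
    (hB : #B < θ) {a : Fin n → M} (ha : FreeFrom θ R (Set.range a) B P)
    (h : RankGE θ R α (tp L B a)) :
    RankGE θ (indepP θ R P) α (tp (L2 L) (M := Pair M P) B a) := by
  have hθ := hM.aleph0_lt
  have has := mk_range_fin_lt hθ a
  induction α using WellFoundedLT.induction generalizing B with
  | _ α ih =>
    rw [rankGE_tp_iff hM hR.isInvariant hB] at h
    refine (rankGE_tp_iff hP (isInvariant_indepP hR) hB).2 fun β hβ => ?_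
    obtain ⟨C, hBC, hC, hfork, hrank⟩ := h β hβ
    obtain ⟨C₀, hC₀, hf, hfork₀⟩ : ∃ C₀ ⊆ C, C₀.Finite ∧ ¬ R (Set.range a) B C₀ := by
      by_contra! hcon
      exact hfork (hR.finite_character_right has hB hC hcon)
    have hBC₀ := mk_union_lt hθ hB (mk_lt_of_finite hθ hf)
    have hrank₀ : RankGE θ R β (tp L (B ∪ C₀) a) :=
      hrank.mono_base hM hR hC (Set.union_subset hBC hC₀)
    obtain ⟨m, c, -, rfl⟩ := hf.fin_param
    have hcs := mk_range_fin_lt hθ c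
    have hBa := mk_union_lt hθ hB has
    obtain ⟨σ, hσ, hσP⟩ := exists_aut_freeFrom hM hR hsup hP hDen hExt hκ c hBa
    have hσB := image_eq_of_fixes σ (B := B) fun b hb => hσ b (Or.inl hb)
    have hσa : σ ∘ a = a := funext fun i => hσ _ (Or.inr ⟨i, rfl⟩)
    have hσc := mk_range_fin_lt hθ (σ ∘ c)
    have hD := mk_union_lt hθ hB hσc
    have hrank' : RankGE θ R β (tp L (B ∪ Set.range (σ ∘ c)) a) :=
      hrank₀.aut hM hR.isInvariant hBC₀ σ (by rw [Set.image_union, hσB, Set.range_comp]) hσa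
    have hfork' : ¬ R (Set.range a) B (Set.range (σ ∘ c)) := by
      rw [← hR.aut_iff has hB hcs σ, hσB, ← Set.range_comp, ← Set.range_comp, hσa] at hfork₀
      exact hfork₀
    have hfree : FreeFrom θ R (Set.range a) (B ∪ Set.range (σ ∘ c)) P := by
      intro P' hP' hs
      have h1 : R (Set.range a ∪ Set.range (σ ∘ c)) B P' :=
        hR.trans_left hθ has hB hs hσc (ha P' hP' hs) (hσP P' hP' hs)
      have h2 := hR.symmetry _ _ _ (mk_union_lt hθ has hσc) hB hs h1
      exact hR.symmetry _ _ _ hs hD has (hR.mono_base hθ hs hB (mk_union_lt hθ has hσc) h2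
        Set.subset_union_left (Set.union_subset_union_right B Set.subset_union_right)
        (Set.subset_union_left.trans Set.subset_union_right))
    refine ⟨B ∪ Set.range (σ ∘ c), Set.subset_union_left, hD, fun hind => hfork' ?_,
      ih β hβ hD hfree hrank'⟩
    obtain ⟨B'', h₁, h₂, h₃, h₄⟩ := hind (Set.range a) subset_rfl B Set.subset_union_left
      (Set.range (σ ∘ c)) Set.subset_union_right has hB hσc
    have hPB : #(P ∩ B'' : Set M) < θ := mk_lt_of_subset h₃ Set.inter_subset_right
    have hB'' : B'' = B ∪ (P ∩ B'') := by
      refine Set.Subset.antisymm (fun x hx => ?_) (Set.union_subset h₁ Set.inter_subset_right)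
      rcases h₂ hx with h | h
      · exact Or.inl h
      · exact Or.inr ⟨h, hx⟩
    rw [hB''] at h₄
    exact hR.mono_right has hB (mk_union_lt hθ hPB hσc)
      (hR.trans_right hθ has hB hPB hσc (ha _ Set.inter_subset_left hPB) h₄)
      Set.subset_union_right

/-- Over a part of `P` containing a base for the independence of `a` from `P`, forking in the pair
is witnessed by forking of `L`-types. -/
theorem RankGE.of_pair (hM : IsMonster L M θ)
    (hR : IsIndependenceRelation L θ R) (hsup : IsSuperior θ R)
    (hP : IsMonster (L2 L) (Pair M P) θ) {n : ℕ} {α : Ordinal.{u}} {B P₀ : Set M}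
    (hB : #B < θ) (hP₀ : P₀ ⊆ P) (hP₀s : #P₀ < θ) {a : Fin n → M}
    (ha : FreeFrom θ R (Set.range a) (B ∪ P₀) P)
    (h : RankGE θ (indepP θ R P) α (tp (L2 L) (M := Pair M P) B a)) :
    RankGE θ R α (tp L (B ∪ P₀) a) := by
  have hθ := hM.aleph0_lt
  have has := mk_range_fin_lt hθ a
  induction α using WellFoundedLT.induction generalizing B P₀ with
  | _ α ih =>
    have hBP₀ := mk_union_lt hθ hB hP₀s
    have h' : ∀ β < α, ∃ C : Set M, B ⊆ C ∧ #C < θ ∧ ¬ IndepLarge θ R (Set.range a) (B ∪ P) C ∧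
        RankGE θ (indepP θ R P) β (tp (L2 L) (M := Pair M P) C a) :=
      (rankGE_tp_iff hP (isInvariant_indepP hR) hB).1 h
    rw [rankGE_tp_iff hM hR.isInvariant hBP₀]
    intro β hβ
    obtain ⟨C, hBC, hC, hfork, hrank⟩ := h' β hβ
    obtain ⟨P₁, hP₁, hf₁, hfree⟩ := hsup.exists_freeFrom hR hθ (Set.finite_range a)
      (mk_union_lt hθ hC hP₀s) P
    rw [Set.union_assoc] at hfree
    have hQ : P₀ ∪ P₁ ⊆ P := Set.union_subset hP₀ hP₁
    have hQs := mk_union_lt hθ hP₀s (mk_lt_of_finite hθ hf₁)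
    have hCQ := mk_union_lt hθ hC hQs
    refine ⟨C ∪ (P₀ ∪ P₁), Set.union_subset_union hBC Set.subset_union_left, hCQ,
      fun hind => hfork ?_, ih β hβ hC hQ hQs hfree hrank⟩
    intro A' hA' B' hB' C' hC' hA's hB's hC's
    have hPB : #(P ∩ B' : Set M) < θ := mk_lt_of_subset hB's Set.inter_subset_right
    refine ⟨B ∪ P₀ ∪ (P ∩ B'), ?_, ?_, mk_union_lt hθ hBP₀ hPB, ?_⟩
    · intro x hx
      rcases hB' hx with h | h
      · exact Or.inl (Or.inl h)
      · exact Or.inr ⟨h, hx⟩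
    · exact Set.union_subset (Set.union_subset_union_right B hP₀)
        (Set.inter_subset_left.trans Set.subset_union_right)
    · have hbase : B ∪ P₀ ∪ (C ∪ (P₀ ∪ P₁)) = C ∪ (P₀ ∪ P₁) :=
        Set.union_eq_self_of_subset_left
          (Set.union_subset_union hBC Set.subset_union_left)
      have h1 : R (Set.range a) (B ∪ P₀) (C ∪ (P₀ ∪ P₁) ∪ (P ∩ B')) := by
        refine hR.trans_right hθ has hBP₀ hCQ hPB hind ?_
        rw [hbase]
        exact hfree _ Set.inter_subset_left hPB
      exact hR.mono_left has (mk_union_lt hθ hBP₀ hPB) hC's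
        (hR.mono_base hθ has hBP₀ (mk_union_lt hθ hCQ hPB) h1 Set.subset_union_left
          (Set.union_subset_union_right _ Set.subset_union_right)
          (((hC'.trans Set.subset_union_left).trans Set.subset_union_left).trans
            Set.subset_union_right)) hA'

end PairRank

/-! ### Comparison of the ranks -/

section Comparison

variable {L : FirstOrder.Language.{u, u}} {M : Type u} [L.Structure M] [Nonempty M]
  {θ κ : Cardinal.{u}} {R : Set M → Set M → Set M → Prop} {P : Set M}

omit [Nonempty M] in
theorem rank_le_iff {B : Set M} {n : ℕ} {p : TypeOver L M B n} {x : WithTop Ordinal.{u}} :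
    rank θ R p ≤ x ↔ ∀ α : Ordinal.{u}, RankGE θ R α p → α ≤ x := by
  rw [rank, sSup_le_iff]
  exact ⟨fun h α hα => h α ⟨α, rfl, hα⟩, by rintro h _ ⟨α, rfl, hα⟩; exact h α hα⟩

omit [Nonempty M] in
theorem RankGE.le_rank {B : Set M} {n : ℕ} {p : TypeOver L M B n} {α : Ordinal.{u}}
    (h : RankGE θ R α p) : (α : WithTop Ordinal.{u}) ≤ rank θ R p :=
  rank_le_iff.1 le_rfl α h

omit [Nonempty M] in
theorem realize_addConstants_sumInl {B : Set (Pair M P)} {n : ℕ} (φ : L[[B]].Formula (Fin n))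
    (a : Fin n → Pair M P) :
    (((LHom.sumInl : L →ᴸ L2 L).addConstants B).onFormula φ).Realize a ↔ φ.Realize a :=
  LHom.realize_onFormula _ φ

theorem toL2_subset_formulas_tp_iff {B : Set M} {n : ℕ} {π : PartialTypeOver L M B n}
    {a : Fin n → M} : toL2 (Q := P) π ⊆ formulas (tp (L2 L) (M := Pair M P) B a) ↔
      π ⊆ formulas (tp L B a) := by
  have key : ∀ φ : L[[B]].Formula (Fin n),
      ((LHom.sumInl : L →ᴸ L2 L).addConstants B).onFormula φ ∈
        formulas (tp (L2 L) (M := Pair M P) B a) ↔ φ ∈ formulas (tp L B a) := by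
    intro φ
    refine (mem_formulas_typeOf (L := L2 L) (M := Pair M P)).trans
      (Iff.trans ?_ mem_formulas_typeOf.symm)
    exact realize_addConstants_sumInl (P := P) φ a
  constructor
  · intro h φ hφ
    exact (key φ).1 (h ⟨φ, hφ, rfl⟩)
  · rintro h _ ⟨φ, hφ, rfl⟩
    exact (key φ).2 (h hφ)

/-- The rank of a partial `L`-type is not changed by passing to the pair. -/
theorem partialRank_eq_partialRank_toL2 (hM : IsMonster L M θ)
    (hR : IsIndependenceRelation L θ R) (hsup : IsSuperior θ R)
    (hP : IsMonster (L2 L) (Pair M P) θ) (hDen : DensityProperty L R κ ⊤ P)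
    (hExt : ExtensionProperty L θ R κ ⊤ P) (hκ : ℵ₀ < κ) {n : ℕ} {B : Set M} (hB : #B < θ)
    (π : PartialTypeOver L M B n) :
    partialRank θ R π = partialRank θ (indepP θ R P) (toL2 (Q := P) π) := by
  have hθ := hM.aleph0_lt
  apply le_antisymm
  · refine iSup_le fun ⟨q, hq⟩ => ?_
    obtain ⟨a₀, rfl⟩ := hM.saturated.exists_eq_tp hB q
    obtain ⟨σ, hσ, hfree⟩ := exists_aut_freeFrom hM hR hsup hP hDen hExt hκ a₀ hB
    rw [← tp_comp_aut a₀ σ hσ] at hq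
    change rank θ R (tp L B a₀) ≤ _
    rw [← tp_comp_aut a₀ σ hσ]
    refine le_trans ?_ (le_iSup (fun q : {q : TypeOver (L2 L) (Pair M P) B n //
      toL2 (Q := P) π ⊆ formulas q} => rank θ (indepP θ R P) q.1)
      ⟨_, toL2_subset_formulas_tp_iff.2 hq⟩)
    exact rank_le_iff.2 fun α hα =>
      (hα.pair_of_freeFrom hM hR hsup hP hDen hExt hκ hB hfree).le_rank
  · refine iSup_le fun ⟨r, hr⟩ => ?_
    obtain ⟨a, rfl⟩ := hP.saturated.exists_eq_tp hB r
    refine le_trans ?_ (le_iSup (fun q : {q : TypeOver L M B n // π ⊆ formulas q} =>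
      rank θ R q.1) ⟨tp L B (a : Fin n → M), toL2_subset_formulas_tp_iff.1 hr⟩)
    refine rank_le_iff.2 fun α hα => RankGE.le_rank ?_
    obtain ⟨P₀, hP₀, hf, hfree⟩ := hsup.exists_freeFrom hR hθ
      (Set.finite_range (a : Fin n → M)) hB P
    have hs := mk_lt_of_finite hθ hf
    exact (RankGE.of_pair hM hR hsup hP hB hP₀ hs hfree hα).mono_base hM hR
      (mk_union_lt hθ hB hs) Set.subset_union_left

omit [Nonempty M] in
/-- Complete types are maximal, so inclusion between them is equality. -/
theorem eq_of_formulas_subset {B : Set M} {n : ℕ} {p q : TypeOver L M B n}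
    (h : formulas p ⊆ formulas q) : q = p := by
  have key : ∀ φ, φ ∈ p → φ ∈ q := by
    intro φ hφ
    have : Formula.equivSentence (Formula.equivSentence.symm φ) ∈ q := h (by
      change Formula.equivSentence (Formula.equivSentence.symm φ) ∈ p
      rwa [Equiv.apply_symm_apply])
    rwa [Equiv.apply_symm_apply] at this
  refine SetLike.ext fun φ => ⟨fun hφ => ?_, key φ⟩
  rcases p.mem_or_not_mem φ with h1 | h1
  · exact h1
  · exact absurd hφ ((Theory.CompleteType.not_mem_iff _ φ).1 (key _ h1))

omit [Nonempty M] in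
theorem partialRank_formulas {B : Set M} {n : ℕ} (q : TypeOver L M B n) :
    partialRank θ R (formulas q) = rank θ R q := by
  apply le_antisymm
  · exact iSup_le fun r => (congrArg (rank θ R) (eq_of_formulas_subset r.2)).le
  · exact le_iSup (fun r : {r : TypeOver L M B n // formulas q ⊆ formulas r} => rank θ R r.1)
      ⟨q, subset_rfl⟩

end Comparison

end LovelyPairs

theorem mainTheorem10 {L : FirstOrder.Language.{u, u}} {M : Type u} [L.Structure M] [Nonempty M]
    (θ : Cardinal.{u}) (hM : LovelyPairs.IsMonster L M θ)
    (R : Set M → Set M → Set M → Prop) (hR : LovelyPairs.IsIndependenceRelation L θ R)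
    (κ : Cardinal.{u}) (hκ : max (LovelyPairs.kappaZero θ R) (max L.card ℵ₀) < κ) (hκθ : κ < θ)
    (hfo : LovelyPairs.LovelinessIsFirstOrder L θ R κ)
    (P : Set M) (hP : LovelyPairs.IsMonster (LovelyPairs.L2 L) (LovelyPairs.Pair M P) θ)
    (hPd : LovelyPairs.Pair M P ⊨ LovelyPairs.lovelyTheory L θ R κ)
    (hsup : LovelyPairs.IsSuperior θ R) :
    (∀ (n : ℕ) (B : Set M), #B < θ → ∀ q : LovelyPairs.TypeOver L M B n,
      LovelyPairs.rank θ R q =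
        LovelyPairs.partialRank θ (LovelyPairs.indepP θ R P)
          (LovelyPairs.toL2 (Q := P) (LovelyPairs.formulas q))) ∧
    (∀ (n : ℕ) (B : Set M), #B < θ → ∀ π : LovelyPairs.PartialTypeOver L M B n,
      LovelyPairs.partialRank θ R π =
        LovelyPairs.partialRank θ (LovelyPairs.indepP θ R P)
          (LovelyPairs.toL2 (Q := P) π)) := by
  have hκ₀ : ℵ₀ < κ := ((le_max_right _ _).trans (le_max_right _ _)).trans_lt hκ
  obtain ⟨hDen, hExt⟩ := hfo.top hP hPd
  have main := fun (n : ℕ) (B : Set M) (hB : #B < θ) (π : LovelyPairs.PartialTypeOver L M B n) =>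
    LovelyPairs.partialRank_eq_partialRank_toL2 hM hR hsup hP hDen hExt hκ₀ hB π
  exact ⟨fun n B hB q => (LovelyPairs.partialRank_formulas q).symm.trans (main n B hB _), main⟩
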